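/- Let $d\ge 2$, $\lambda\in\{-1,+1\}$ and $\mathbb T^d=(\mathbb R/2\pi\mathbb Z)^d$. Let $W$ be the Wiener algebra of functions $f(x)=\sum_{j\in\mathbb Z^d}b_je^{ij\cdot x}$ with $\|f\|_W=\sum_j|b_j|<\infty$, and write $u_j(t)$ for the Fourier coefficients of $u(t,\cdot)$. Let $|j|^2=j_1^2+\dots+j_d^2$ and $$\mathcal N_*=\{(0,\pm2^p),(\pm2^p,0),(\pm2^p,\pm2^p),(\mp2^p,\pm2^p):\ p\in\mathbb N\}\times\{0_{\mathbb Z^{d-2}}\},\qquad \mathbb N=\{0,1,2,\dots\}.$$ Consider the Cauchy problem $$i\partial_tu+\Delta u=\lambda\varepsilon|u|^2u,\qquad u(0,x)=1+2\cos x_1+2\cos x_2,\qquad x\in\mathbb T^d,$$ where the equation is understood in the sense of distributions on $\mathbb T^d$ (tested against functions in $C^\infty(\mathbb T^d)$, for every $t$). There exist $\varepsilon_0,T>0$ such that the following holds. 1. For every $\varepsilon\in(0,\varepsilon_0]$ the problem has a unique solution $u=u^\varepsilon\in C([0,T/\varepsilon];W)$. 2. There exist $C_0,C>0$, independent of $\varepsilon$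 and $j$, such that for every $j\in\mathcal N_*$ there is $c_j\in\mathbb C\setminus\{0\}$, independent of $\varepsilon$, such that for all $\varepsilon\in(0,\varepsilon_0]$ and all $t\in[0,T/\varepsilon]$, $$\left|u_j(t)-c_j(\varepsilon t)^{|j|^2-1}e^{-it|j|^2}\right|\le(C_0\varepsilon t)^{|j|^2}+C\varepsilon .$$ 3. For all $\gamma\in(0,1)$, $\theta<1/4$ and $\alpha>0$ there is $\varepsilon_1\in(0,\varepsilon_0]$ such that for all $\varepsilon\in(0,\varepsilon_1]$ and all $j\in\mathcal N_*$ with $1<|j|<\alpha\left(\log\frac1\varepsilon\right)^\theta$, the time $t_j=2\,\varepsilon^{-1+\gamma/(|j|^2-1)}$ lies in $[0,T/\varepsilon]$ and $$|u_j(t_j)|\ge\frac{\varepsilon^\gamma}{4}.$$ -/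

import Mathlib

open MeasureTheory Set Filter Topology
open scoped ContDiff

noncomputable section

namespace NLSCascade

/-- The torus `𝕋^d = (ℝ / 2πℤ)^d`. -/
abbrev Torus (d : ℕ) : Type := Fin d → AddCircle (2 * Real.pi)

/-- The normalized Haar (Lebesgue) measure on the torus, of total mass one. -/
def torusMeasure (d : ℕ) : Measure (Torus d) :=
  haveI : Fact (0 < 2 * Real.pi) := ⟨Real.two_pi_pos⟩
  Measure.pi fun _ => AddCircle.haarAddCircle

/-- The character `x ↦ exp (i j · x)`. -/
def character {d : ℕ} (j : Fin d → ℤ) (x : Torus d) : ℂ :=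
  ∏ i, fourier (j i) (x i)

/-- The Fourier coefficient `f_j = (2π)^{-d} ∫ f(x) exp (- i j · x) dx`. -/
def coeff {d : ℕ} (f : Torus d → ℂ) (j : Fin d → ℤ) : ℂ :=
  ∫ x, f x * character (-j) x ∂(torusMeasure d)

/-- Membership in the Wiener algebra `W`: `f` is the sum of a Fourier series with coefficients
in `ℓ¹(ℤ^d)`. -/
def IsWiener {d : ℕ} (f : Torus d → ℂ) : Prop :=
  ∃ b : (Fin d → ℤ) → ℂ, Summable (fun j => ‖b j‖) ∧
    ∀ x, HasSum (fun j => b j * character j x) (f x)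

/-- The norm of `W`, used only on members of `W` (where the coefficients are summable). -/
def wienerNorm {d : ℕ} (f : Torus d → ℂ) : ℝ :=
  ∑' j, ‖coeff f j‖

/-- `u ∈ C([0,τ]; W)`; only the values `u t` with `t ∈ [0,τ]` matter. -/
def ContinuousInWiener {d : ℕ} (τ : ℝ) (u : ℝ → Torus d → ℂ) : Prop :=
  (∀ t ∈ Icc 0 τ, IsWiener (u t)) ∧
    ∀ t ∈ Icc 0 τ, Tendsto (fun s => wienerNorm (u s - u t)) (𝓝[Icc 0 τ] t) (𝓝 0)

/-- `φ ∈ C^∞(𝕋^d)`: the periodic function on `ℝ^d` induced by `φ` is smooth. -/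
def IsSmooth {d : ℕ} (φ : Torus d → ℂ) : Prop :=
  ContDiff ℝ ∞ fun y : Fin d → ℝ => φ fun i => (y i : AddCircle (2 * Real.pi))

/-- The Laplacian `Δφ = ∑ᵢ ∂ᵢ² φ` of a function on the torus (applied to smooth `φ` only). -/
def laplacian {d : ℕ} (φ : Torus d → ℂ) (x : Torus d) : ℂ :=
  ∑ i, iteratedDeriv 2
    (fun s : ℝ => φ (x + Pi.single i (s : AddCircle (2 * Real.pi)))) 0

/-- `u ∈ C([0,τ]; W)` solves `i ∂ₜu + Δu = μ |u|² u` with `u(0) = u₀`, the equation being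
understood in the sense of distributions on the torus: for every `φ ∈ C^∞(𝕋^d)` and every
`t ∈ [0,τ]` (one-sided derivatives at the end points),
`d/dt (i ∫ u φ) = μ ∫ |u|² u φ - ∫ u Δφ`. -/
structure IsNLSSolution {d : ℕ} (μ : ℝ) (u₀ : Torus d → ℂ) (τ : ℝ) (u : ℝ → Torus d → ℂ) :
    Prop where
  continuous : ContinuousInWiener τ u
  initial : u 0 = u₀
  equation : ∀ φ : Torus d → ℂ, IsSmooth φ → ∀ t ∈ Icc 0 τ,
    HasDerivWithinAt
      (fun s => Complex.I * ∫ x, u s x * φ x ∂(torusMeasure d))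
      ((μ : ℂ) * (∫ x, ((‖u t x‖ ^ 2 : ℝ) : ℂ) * u t x * φ x ∂(torusMeasure d))
        - ∫ x, u t x * laplacian φ x ∂(torusMeasure d))
      (Icc 0 τ) t

/-- The five-mode datum `u₀(x) = 1 + 2 cos x₁ + 2 cos x₂`. -/
def fiveMode {d : ℕ} (hd : 2 ≤ d) (x : Torus d) : ℂ :=
  ((1 + 2 * Real.Angle.cos (x ⟨0, by omega⟩) + 2 * Real.Angle.cos (x ⟨1, by omega⟩) : ℝ) : ℂ)

/-- `|j|² = j₁² + ⋯ + j_d²`, as a natural number. -/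
def normSq {d : ℕ} (j : Fin d → ℤ) : ℕ := ∑ i, (j i).natAbs ^ 2

/-- The Euclidean length `|j|`. -/
def length {d : ℕ} (j : Fin d → ℤ) : ℝ := Real.sqrt (normSq j)

/-- The extremal modes: `(0, ±2^p)`, `(±2^p, 0)`, `(±2^p, ±2^p)`, `(∓2^p, ±2^p)`, `p ∈ ℕ`,
completed by zeros in the last `d - 2` coordinates. -/
def extremalModes {d : ℕ} (hd : 2 ≤ d) : Set (Fin d → ℤ) :=
  {j | (∀ i : Fin d, 2 ≤ (i : ℕ) → j i = 0) ∧ ∃ p : ℕ,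
    (j ⟨0, by omega⟩ = 0 ∧ |j ⟨1, by omega⟩| = 2 ^ p) ∨
    (|j ⟨0, by omega⟩| = 2 ^ p ∧ j ⟨1, by omega⟩ = 0) ∨
    (|j ⟨0, by omega⟩| = 2 ^ p ∧ |j ⟨1, by omega⟩| = 2 ^ p)}

/-- The ignition time `2 / ε^{1 - γ / (|j|² - 1)}` of the mode `j` (for `|j| > 1`). -/
def ignitionTime {d : ℕ} (ε γ : ℝ) (j : Fin d → ℤ) : ℝ :=
  2 / ε ^ (1 - γ / ((normSq j : ℝ) - 1))

end NLSCascade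

end

/-! Write `u_j(t) = e^{-it|j|²} b_j(εt)`. In the slow time `τ = εt` the profile `b` satisfies `b_j'
= -iλ ∑ e^{iωτ/ε} b_k \bar b_l b_m`, summed over `k - l + m = j`, with `ω = |j|² - |k|² + |l|² -
|m|²`. The cubic term is bounded and locally Lipschitz on `ℓ¹`, uniformly in `ε`, so Picard
iteration gives a profile with norm at most 10 on `[0, 1/400]` (`exists_profile`). Weak solutions
and profiles determine each other (`isNLSSolution_synth_flow`, `IsNLSSolution.exists_profile`),
which gives existence and uniqueness in the original variables.

Since `ω` is an integer, a nonzero `ω` has `|ω| ≥ 1`: there are no small divisors, and integrating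
the oscillating terms once in time costs only `O(ε)` (`exists_corrected_profile`). What remains is
the autonomous equation `y' = R(y, y, y)` of the interactions with `ω = 0`. Its Taylor coefficients
decay geometrically (`sum_norm_taylor_le`), and Gronwall's inequality compares the profile directly
with the Taylor polynomials (`exists_norm_profile_sub_taylorPoly_le`).

The Taylor coefficient of order `m` vanishes at frequencies with `|j|² > m + 1`: resonance means
`|j|² + |l|² = |k|² + |m|²`, so reaching a large `|j|²` takes many interactions. In the critical
case `|j|² = m + 1`, `m ≥ 1`, only interactions with `l = 0` at order zero contribute, and all
contributions have the same phase `(-iλ)^m`, so nothing cancels (`leadingAt`). An extremal mode is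
the sum of two orthogonal extremal modes of half its squared length, so induction along this tree
bounds the leading coefficient below by `|j|² / 2^{|j|²-1}` (`le_leadCoef`). In particular it is
nonzero, and it is the constant `c_j`.

At the ignition time `ετ`-scaling gives `εt_j = 2s` with `s^{|j|²-1} = ε^γ`. The factor 2
compensates the loss `2^{-(|j|²-1)}`, so the leading term is at least `ε^γ`. The remainder `(4000
s)^{|j|²}` is at most `ε^γ / 4` once `|j|⁴` is small compared with `log(1/ε)`, which is the origin
of `θ < 1/4`. -/

noncomputable section

namespace NLSCascade

/-! ### The space `ℓ¹` -/

/-- Complex absolutely summable families. -/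
abbrev Ell1 (κ : Type*) : Type _ := lp (fun _ : κ => ℂ) 1

namespace Ell1

variable {κ κ' ι : Type*}

theorem summable_norm (f : Ell1 κ) : Summable fun i => ‖f i‖ := by
  simpa using (lp.memℓp f).summable (by simp)

theorem norm_eq (f : Ell1 κ) : ‖f‖ = ∑' i, ‖f i‖ := by
  simpa using lp.norm_eq_tsum_rpow (by simp) f

theorem summable (f : Ell1 κ) : Summable fun i => f i := f.summable_norm.of_norm

theorem norm_apply_le (f : Ell1 κ) (i : κ) : ‖f i‖ ≤ ‖f‖ :=
  lp.norm_apply_le_norm one_ne_zero f i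

/-- The element of `ℓ¹` given by an absolutely summable family. -/
def mk (f : κ → ℂ) (hf : Summable fun i => ‖f i‖) : Ell1 κ :=
  ⟨f, memℓp_gen (by simpa using hf)⟩

@[simp] theorem mk_apply (f : κ → ℂ) (hf : Summable fun i => ‖f i‖) (i : κ) : mk f hf i = f i :=
  rfl

theorem ext' {f g : Ell1 κ} (h : ∀ i, f i = g i) : f = g := lp.ext (funext h)

@[simp] theorem add_apply' (f g : Ell1 κ) (i : κ) : (f + g) i = f i + g i := rfl
@[simp] theorem sub_apply' (f g : Ell1 κ) (i : κ) : (f - g) i = f i - g i := rfl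
@[simp] theorem smul_apply' (c : ℝ) (f : Ell1 κ) (i : κ) : (c • f) i = c • f i := rfl

/-- Dominated convergence in `ℓ¹`. -/
theorem tendsto_of_dominated {β : Type*} {l : Filter β} {F : β → Ell1 κ} {f : Ell1 κ}
    {bound : κ → ℝ} (hb : Summable bound) (hlim : ∀ i, Tendsto (fun n => F n i) l (𝓝 (f i)))
    (hF : ∀ᶠ n in l, ∀ i, ‖F n i‖ ≤ bound i) : Tendsto F l (𝓝 f) := by
  rw [tendsto_iff_norm_sub_tendsto_zero]
  have key : Tendsto (fun n => ∑' i, ‖F n i - f i‖) l (𝓝 (∑' _ : κ, (0 : ℝ))) := by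
    refine tendsto_tsum_of_dominated_convergence (bound := fun i => bound i + ‖f i‖)
      (hb.add f.summable_norm) (fun i => ?_) ?_
    · simpa using ((hlim i).sub_const (f i)).norm
    · filter_upwards [hF] with n hn i
      rw [norm_norm]
      exact (norm_sub_le _ _).trans (by gcongr; exact hn i)
  simpa [norm_eq] using key

/-- Evaluation at an index. -/
def eval (i : κ) : Ell1 κ →L[ℝ] ℂ :=
  LinearMap.mkContinuous
    { toFun := fun f => f i, map_add' := fun _ _ => rfl, map_smul' := fun _ _ => rfl } 1
    fun f => by rw [one_mul]; exact norm_apply_le f i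

@[simp] theorem eval_apply (i : κ) (f : Ell1 κ) : eval i f = f i := rfl

/-- The sum of a family in `ℓ¹`. -/
def total : Ell1 κ →L[ℝ] ℂ :=
  LinearMap.mkContinuous
    { toFun := fun f => ∑' i, f i
      map_add' := fun f g => f.summable.tsum_add g.summable
      map_smul' := fun c f => by
        simpa using f.summable.tsum_const_smul c } 1
    fun f => by rw [one_mul, norm_eq]; exact norm_tsum_le_tsum_norm f.summable_norm

theorem total_apply (f : Ell1 κ) : total f = ∑' i, f i := rfl

/-- Multiplication by a bounded weight. -/
def mulW {C : ℝ} (w : κ → ℂ) (hw : ∀ i, ‖w i‖ ≤ C) : Ell1 κ →L[ℝ] Ell1 κ :=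
  LinearMap.mkContinuous
    { toFun := fun f => mk (fun i => w i * f i)
        (Summable.of_nonneg_of_le (fun _ => norm_nonneg _)
          (fun i => by rw [norm_mul]; exact mul_le_mul_of_nonneg_right (hw i) (norm_nonneg _))
          (f.summable_norm.mul_left C))
      map_add' := fun f g => ext' fun i => by simp [mul_add]
      map_smul' := fun c f => ext' fun i => by simp; ring } C
    fun f => by
      rw [norm_eq, norm_eq, ← tsum_mul_left]
      refine Summable.tsum_le_tsum (fun i => ?_) (summable_norm _) (f.summable_norm.mul_left C)
      simpa using mul_le_mul_of_nonneg_right (hw i) (norm_nonneg (f i))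

@[simp] theorem mulW_apply {C : ℝ} (w : κ → ℂ) (hw : ∀ i, ‖w i‖ ≤ C) (f : Ell1 κ) (i : κ) :
    mulW w hw f i = w i * f i := rfl

theorem norm_mulW_le {C : ℝ} (w : κ → ℂ) (hw : ∀ i, ‖w i‖ ≤ C) (f : Ell1 κ) :
    ‖mulW w hw f‖ ≤ C * ‖f‖ := by
  rw [norm_eq, norm_eq, ← tsum_mul_left]
  refine Summable.tsum_le_tsum (fun i => ?_) (summable_norm _) (f.summable_norm.mul_left C)
  simpa using mul_le_mul_of_nonneg_right (hw i) (norm_nonneg (f i))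

theorem tendsto_mulW {β : Type*} {l : Filter β} {C : ℝ} {w : β → κ → ℂ} {v : κ → ℂ}
    (hw : ∀ n i, ‖w n i‖ ≤ C) (hv : ∀ i, ‖v i‖ ≤ C)
    (h : ∀ i, Tendsto (fun n => w n i) l (𝓝 (v i))) {F : β → Ell1 κ} {f : Ell1 κ}
    (hF : Tendsto F l (𝓝 f)) :
    Tendsto (fun n => mulW (w n) (hw n) (F n)) l (𝓝 (mulW v hv f)) := by
  have h1 : Tendsto (fun n => mulW (w n) (hw n) f) l (𝓝 (mulW v hv f)) :=
    tendsto_of_dominated (f.summable_norm.mul_left C)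
      (fun i => by simpa using (h i).mul_const (f i))
      (Eventually.of_forall fun n i => by
        simpa using mul_le_mul_of_nonneg_right (hw n i) (norm_nonneg (f i)))
  have h2 : Tendsto (fun n => mulW (w n) (hw n) (F n - f)) l (𝓝 0) := by
    refine squeeze_zero_norm (fun n => norm_mulW_le _ _ _) ?_
    simpa using (tendsto_iff_norm_sub_tendsto_zero.1 hF).const_mul C
  simpa using h2.add h1

/-- Product rule for weights that are differentiable only index by index. The mean value inequality
turns the uniform bound on `w'` into a uniform bound on the difference quotients of `w`, and
dominated convergence in `ℓ¹` does the rest. -/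
theorem hasDerivWithinAt_mulW {C : ℝ} {w w' : ℝ → κ → ℂ} (hw : ∀ t i, ‖w t i‖ ≤ C)
    (hw' : ∀ t i, ‖w' t i‖ ≤ C) (hd : ∀ t i, HasDerivAt (fun τ => w τ i) (w' t i) t)
    {f : ℝ → Ell1 κ} {f' : Ell1 κ} {s : Set ℝ} {t : ℝ} (hf : HasDerivWithinAt f f' s t) :
    HasDerivWithinAt (fun τ => mulW (w τ) (hw τ) (f τ))
      (mulW (w' t) (hw' t) (f t) + mulW (w t) (hw t) f') s t := by
  rw [hasDerivWithinAt_iff_tendsto_slope] at hf ⊢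
  have h1 : Tendsto (fun τ => mulW (w τ) (hw τ) (slope f t τ)) (𝓝[s \ {t}] t)
      (𝓝 (mulW (w t) (hw t) f')) :=
    tendsto_mulW (fun n => hw n) (hw t)
      (fun i => (hd t i).continuousAt.tendsto.mono_left nhdsWithin_le_nhds) hf
  have h2 : Tendsto (fun τ => slope (fun τ => mulW (w τ) (hw τ) (f t)) t τ) (𝓝[s \ {t}] t)
      (𝓝 (mulW (w' t) (hw' t) (f t))) := by
    refine tendsto_of_dominated ((f t).summable_norm.mul_left C) (fun i => ?_)
      (Eventually.of_forall fun τ i => ?_)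
    · have := ((hd t i).hasDerivWithinAt (s := s)).mul_const (f t i)
      rw [hasDerivWithinAt_iff_tendsto_slope] at this
      exact this
    · have h3 : ‖w τ i - w t i‖ ≤ C * ‖τ - t‖ :=
        convex_univ.norm_image_sub_le_of_norm_hasDerivWithin_le
          (fun x _ => (hd x i).hasDerivWithinAt) (fun x _ => hw' x i) (mem_univ _) (mem_univ _)
      have h4 : ‖(τ - t)⁻¹‖ * ‖w τ i - w t i‖ ≤ C := by
        rcases eq_or_ne τ t with rfl | hne
        · simpa using (norm_nonneg _).trans (hw τ i)
        · rw [norm_inv, inv_mul_le_iff₀ (norm_pos_iff.2 (sub_ne_zero.2 hne)), mul_comm]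
          exact h3
      have h5 : (slope (fun τ => mulW (w τ) (hw τ) (f t)) t τ) i
          = ((τ - t)⁻¹ : ℝ) • ((w τ i - w t i) * f t i) := by
        simp [slope, sub_mul]
      rw [h5, norm_smul, norm_mul, ← mul_assoc]
      exact mul_le_mul_of_nonneg_right h4 (norm_nonneg _)
  refine (h2.add h1).congr fun τ => ?_
  simp only [slope, vsub_eq_sub, map_smul, map_sub, ← smul_add]
  congr 1
  abel

/-- The tensor product of two families. -/
def tens : Ell1 κ →L[ℝ] Ell1 κ' →L[ℝ] Ell1 (κ × κ') :=
  LinearMap.mkContinuous₂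
    (LinearMap.mk₂ ℝ (fun f g => mk (fun x : κ × κ' => f x.1 * g x.2)
        (f.summable_norm.mul_norm g.summable_norm))
      (fun _ _ _ => ext' fun i => by simp [add_mul])
      (fun _ _ _ => ext' fun i => by simp; ring)
      (fun _ _ _ => ext' fun i => by simp [mul_add])
      (fun _ _ _ => ext' fun i => by simp; ring)) 1
    fun f g => by
      have := tsum_mul_tsum_of_summable_norm f.summable_norm.norm g.summable_norm.norm
      simp only [LinearMap.mk₂_apply, norm_eq, one_mul, this]
      simp

@[simp] theorem tens_apply (f : Ell1 κ) (g : Ell1 κ') (x : κ × κ') :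
    tens f g x = f x.1 * g x.2 := rfl

theorem norm_tens (f : Ell1 κ) (g : Ell1 κ') : ‖tens f g‖ = ‖f‖ * ‖g‖ := by
  have := tsum_mul_tsum_of_summable_norm f.summable_norm.norm g.summable_norm.norm
  simp only [norm_eq, this]
  simp

/-! ### Summation over the fibres of a map of indices -/

section push

theorem hasSum_fiber [DecidableEq ι] {E : Type*} [AddCommMonoid E] [TopologicalSpace E]
    (g : κ → ι) (f : κ → E) (x : κ) : HasSum (fun j => if g x = j then f x else 0) (f x) := by
  convert hasSum_ite_eq (g x) (f x) using 2 with j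
  by_cases hj : g x = j
  · simp [hj]
  · simp [hj, Ne.symm hj]

open Classical in
theorem summable_fiber (g : κ → ι) (f : Ell1 κ) :
    Summable fun z : κ × ι => ‖if g z.1 = z.2 then f z.1 else 0‖ := by
  have h : ∀ x : κ, HasSum (fun j => ‖if g x = j then f x else 0‖) ‖f x‖ := fun x => by
    convert hasSum_fiber g (fun x => ‖f x‖) x using 2 with j
    split_ifs <;> simp
  refine (summable_prod_of_nonneg fun _ => norm_nonneg _).2 ⟨fun x => (h x).summable, ?_⟩
  simpa only [(h _).tsum_eq] using f.summable_norm

open Classical in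
theorem summable_norm_fiber (g : κ → ι) (f : Ell1 κ) (j : ι) :
    Summable fun x => ‖if g x = j then f x else 0‖ :=
  (summable_fiber g f).prod_symm.prod_factor j

open Classical in
theorem summable_norm_push (g : κ → ι) (f : Ell1 κ) :
    Summable fun j => ‖∑' x, if g x = j then f x else 0‖ :=
  Summable.of_nonneg_of_le (fun _ => norm_nonneg _)
    (fun j => norm_tsum_le_tsum_norm (summable_norm_fiber g f j))
    (summable_fiber g f).prod_symm.prod

open Classical in
theorem tsum_norm_push_le (g : κ → ι) (f : Ell1 κ) :
    ∑' j, ‖∑' x, if g x = j then f x else 0‖ ≤ ‖f‖ := by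
  have h : ∀ x : κ, HasSum (fun j => ‖if g x = j then f x else 0‖) ‖f x‖ := fun x => by
    convert hasSum_fiber g (fun x => ‖f x‖) x using 2 with j
    split_ifs <;> simp
  calc ∑' j, ‖∑' x, if g x = j then f x else 0‖
      ≤ ∑' j, ∑' x, ‖if g x = j then f x else 0‖ :=
        (summable_norm_push g f).tsum_le_tsum
          (fun j => norm_tsum_le_tsum_norm (summable_norm_fiber g f j))
          (summable_fiber g f).prod_symm.prod
    _ = ∑' x, ∑' j, ‖if g x = j then f x else 0‖ :=
        Summable.tsum_comm (f := fun (x : κ) (j : ι) => ‖if g x = j then f x else 0‖)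
          (summable_fiber g f)
    _ = ‖f‖ := by simp only [(h _).tsum_eq, norm_eq]

open Classical in
/-- The image of a family under a map of index sets, as a linear map. -/
def pushₗ (g : κ → ι) : Ell1 κ →ₗ[ℝ] Ell1 ι where
  toFun f := mk (fun j => ∑' x, if g x = j then f x else 0) (summable_norm_push g f)
  map_add' f f' := ext' fun j => by
    rw [add_apply', mk_apply, mk_apply, mk_apply,
      ← (summable_norm_fiber g f j).of_norm.tsum_add (summable_norm_fiber g f' j).of_norm]
    refine tsum_congr fun x => ?_
    split_ifs <;> simp
  map_smul' c f := ext' fun j => by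
    rw [RingHom.id_apply, smul_apply', mk_apply, mk_apply,
      ← (summable_norm_fiber g f j).of_norm.tsum_const_smul c]
    refine tsum_congr fun x => ?_
    split_ifs <;> simp

/-- The image of a family under a map of index sets. -/
def push (g : κ → ι) : Ell1 κ →L[ℝ] Ell1 ι :=
  (pushₗ g).mkContinuous 1 fun f => by
    rw [one_mul, norm_eq]
    exact tsum_norm_push_le g f

open Classical in
theorem push_apply (g : κ → ι) (f : Ell1 κ) (j : ι) :
    push g f j = ∑' x, if g x = j then f x else 0 := rfl

theorem norm_push_le (g : κ → ι) (f : Ell1 κ) : ‖push g f‖ ≤ ‖f‖ := by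
  rw [norm_eq]
  exact tsum_norm_push_le g f

theorem total_push (g : κ → ι) (f : Ell1 κ) : total (push g f) = total f := by
  classical
  simp only [total_apply, push_apply]
  rw [Summable.tsum_comm (f := fun (x : κ) (j : ι) => if g x = j then f x else 0)
    (summable_fiber g f).of_norm]
  simp only [(hasSum_fiber g f _).tsum_eq]

theorem mulW_push {C : ℝ} (g : κ → ι) (w : ι → ℂ) (hw : ∀ j, ‖w j‖ ≤ C) (f : Ell1 κ) :
    mulW w hw (push g f) = push g (mulW (fun x => w (g x)) (fun x => hw (g x)) f) := by
  refine ext' fun j => ?_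
  simp only [mulW_apply, push_apply]
  rw [← tsum_mul_left]
  congr with x
  split_ifs with h <;> simp [h]

end push

end Ell1

/-! ### Characters, Fourier coefficients and the Wiener algebra -/

instance fact_two_pi_pos : Fact (0 < 2 * Real.pi) := ⟨Real.two_pi_pos⟩

section Character

variable {d : ℕ}

instance : IsProbabilityMeasure (torusMeasure d) := by
  unfold torusMeasure; infer_instance

instance : (torusMeasure d).IsAddHaarMeasure := by
  unfold torusMeasure; infer_instance

theorem continuous_character (j : Fin d → ℤ) : Continuous (character j) := by
  unfold character; fun_prop

theorem norm_character (j : Fin d → ℤ) (x : Torus d) : ‖character j x‖ = 1 := by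
  rw [character, norm_prod]
  exact Finset.prod_eq_one fun i _ => Circle.norm_coe _

theorem character_add (j k : Fin d → ℤ) (x : Torus d) :
    character (j + k) x = character j x * character k x := by
  simp [character, Finset.prod_mul_distrib]

theorem character_neg (j : Fin d → ℤ) (x : Torus d) :
    character (-j) x = star (character j x) := by
  simp [character]

theorem character_apply_add (j : Fin d → ℤ) (x y : Torus d) :
    character j (x + y) = character j x * character j y := by
  simp [character, fourier_apply, smul_add, AddCircle.toCircle_add, Finset.prod_mul_distrib]

theorem fourier_two_pi (n : ℤ) (s : ℝ) :
    fourier n (s : AddCircle (2 * Real.pi)) = Complex.exp (Complex.I * n * s) := by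
  rw [fourier_coe_apply]
  congr 1
  have : (Real.pi : ℂ) ≠ 0 := by exact_mod_cast Real.pi_ne_zero
  push_cast
  field_simp

theorem character_single (j : Fin d → ℤ) (i : Fin d) (s : ℝ) :
    character j (Pi.single i (s : AddCircle (2 * Real.pi)))
      = Complex.exp (Complex.I * j i * s) := by
  rw [character, Finset.prod_eq_single i]
  · rw [Pi.single_eq_same, fourier_two_pi]
  · intro k _ hk
    rw [Pi.single_eq_of_ne hk]; exact fourier_eval_zero _
  · simp

theorem integral_fourier (n : ℤ) :
    ∫ x : AddCircle (2 * Real.pi), fourier n x ∂AddCircle.haarAddCircle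
      = if n = 0 then 1 else 0 := by
  have h := congrFun (fourierCoeff_fourier (T := 2 * Real.pi) n) 0
  simp only [fourierCoeff, neg_zero, fourier_zero, one_smul] at h
  rw [h, Pi.single_apply]
  simp [eq_comm]

theorem integral_character (j : Fin d → ℤ) :
    ∫ x, character j x ∂(torusMeasure d) = if j = 0 then 1 else 0 := by
  unfold character torusMeasure
  rw [integral_fintype_prod_eq_prod (fun i (x : AddCircle (2 * Real.pi)) => fourier (j i) x)]
  simp only [integral_fourier]
  split_ifs with h
  · simp [h]
  · obtain ⟨i, hi⟩ := Function.ne_iff.1 h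
    exact Finset.prod_eq_zero (Finset.mem_univ i) (by simpa using hi)

theorem integrable_of_continuous {f : Torus d → ℂ} (hf : Continuous f) :
    Integrable f (torusMeasure d) :=
  hf.integrable_of_hasCompactSupport (HasCompactSupport.of_compactSpace f)

end Character

/-! ### Fourier synthesis and the cubic product -/

section Synth

variable {d : ℕ}

theorem summable_norm_mul_character (a : Ell1 (Fin d → ℤ)) (x : Torus d) :
    Summable fun j => ‖a j * character j x‖ := by
  simpa [norm_character] using a.summable_norm

/-- The function with given absolutely summable Fourier coefficients. -/
def synth (a : Ell1 (Fin d → ℤ)) (x : Torus d) : ℂ := ∑' j, a j * character j x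

theorem hasSum_synth (a : Ell1 (Fin d → ℤ)) (x : Torus d) :
    HasSum (fun j => a j * character j x) (synth a x) :=
  (summable_norm_mul_character a x).of_norm.hasSum

theorem synth_add (a b : Ell1 (Fin d → ℤ)) : synth (a + b) = synth a + synth b := by
  ext x
  refine (hasSum_synth _ x).unique ?_
  simpa [add_mul] using (hasSum_synth a x).add (hasSum_synth b x)

theorem synth_sub (a b : Ell1 (Fin d → ℤ)) : synth (a - b) = synth a - synth b := by
  ext x
  refine (hasSum_synth _ x).unique ?_
  simpa [sub_mul] using (hasSum_synth a x).sub (hasSum_synth b x)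

theorem synth_single (j : Fin d → ℤ) :
    synth (lp.single 1 j (1 : ℂ) : Ell1 (Fin d → ℤ)) = character j := by
  ext x
  refine (hasSum_synth _ x).unique ?_
  have := hasSum_single (f := fun k => (lp.single 1 j (1 : ℂ) : Ell1 (Fin d → ℤ)) k * character k x)
    j (fun k hk => by rw [lp.single_apply_ne _ _ _ hk, zero_mul])
  simpa using this

/-- The pairing of a character with a function, without conjugation. -/
def pairing (φ : Torus d → ℂ) (j : Fin d → ℤ) : ℂ :=
  ∫ x, character j x * φ x ∂(torusMeasure d)

/-- Termwise integration is legitimate because the `j`-th term is bounded by `‖a j‖` times the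
supremum of `φ`. -/
theorem hasSum_integral_synth_mul (a : Ell1 (Fin d → ℤ)) {φ : Torus d → ℂ} (hφ : Continuous φ) :
    HasSum (fun j => a j * pairing φ j) (∫ x, synth a x * φ x ∂(torusMeasure d)) := by
  have hi : ∀ j, Integrable (fun x => a j * character j x * φ x) (torusMeasure d) := fun j =>
    integrable_of_continuous (by have := continuous_character j; fun_prop)
  obtain ⟨M, hM⟩ := isCompact_univ.exists_bound_of_continuousOn hφ.continuousOn
  have h := hasSum_integral_of_summable_integral_norm hi ?_
  · have h1 : ∀ x, ∑' j, a j * character j x * φ x = synth a x * φ x := fun x =>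
      ((hasSum_synth a x).mul_right (φ x)).tsum_eq
    have h2 : ∀ j, ∫ x, a j * character j x * φ x ∂(torusMeasure d) = a j * pairing φ j :=
      fun j => by simp only [pairing, mul_assoc, integral_const_mul]
    simpa only [h1, h2] using h
  · refine Summable.of_nonneg_of_le (fun j => integral_nonneg fun x => norm_nonneg _)
      (fun j => ?_) (a.summable_norm.mul_right M)
    calc ∫ x, ‖a j * character j x * φ x‖ ∂(torusMeasure d)
        ≤ ∫ _, ‖a j‖ * M ∂(torusMeasure d) := by
          refine integral_mono (hi j).norm (integrable_const _) fun x => ?_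
          simp only [norm_mul, norm_character, mul_one]
          exact mul_le_mul_of_nonneg_left (hM x (mem_univ x)) (norm_nonneg _)
      _ = ‖a j‖ * M := by simp

theorem pairing_character (j k : Fin d → ℤ) :
    pairing (character (-j)) k = if k = j then 1 else 0 := by
  simp only [pairing, ← character_add, integral_character, add_neg_eq_zero]

theorem coeff_synth (a : Ell1 (Fin d → ℤ)) (j : Fin d → ℤ) : coeff (synth a) j = a j := by
  refine (hasSum_integral_synth_mul a (continuous_character (-j))).unique ?_
  have := hasSum_single (f := fun k => a k * pairing (character (-j)) k) j
    (fun k hk => by simp [pairing_character, hk])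
  simpa [pairing_character] using this

theorem synth_injective : Function.Injective (synth (d := d)) := fun a b h =>
  Ell1.ext' fun j => by rw [← coeff_synth a, ← coeff_synth b, h]

theorem isWiener_iff {f : Torus d → ℂ} : IsWiener f ↔ ∃ a, f = synth a := by
  constructor
  · rintro ⟨b, hb, h⟩
    exact ⟨Ell1.mk b hb, funext fun x => (h x).unique (hasSum_synth (Ell1.mk b hb) x)⟩
  · rintro ⟨a, rfl⟩
    exact ⟨a, a.summable_norm, hasSum_synth a⟩

theorem wienerNorm_synth (a : Ell1 (Fin d → ℤ)) : wienerNorm (synth a) = ‖a‖ := by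
  simp [wienerNorm, coeff_synth, Ell1.norm_eq]

/-- The frequency produced by the interaction `(k, l, m)`. -/
def outFreq (x : (Fin d → ℤ) × (Fin d → ℤ) × (Fin d → ℤ)) : Fin d → ℤ := x.1 - x.2.1 + x.2.2

/-- The family `a_k \bar b_l c_m`. -/
def cub (a b c : Ell1 (Fin d → ℤ)) : Ell1 ((Fin d → ℤ) × (Fin d → ℤ) × (Fin d → ℤ)) :=
  Ell1.tens a (Ell1.tens (star b) c)

theorem cub_apply (a b c : Ell1 (Fin d → ℤ)) (x : (Fin d → ℤ) × (Fin d → ℤ) × (Fin d → ℤ)) :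
    cub a b c x = a x.1 * (star (b x.2.1) * c x.2.2) := rfl

theorem norm_cub (a b c : Ell1 (Fin d → ℤ)) : ‖cub a b c‖ = ‖a‖ * ‖b‖ * ‖c‖ := by
  rw [cub, Ell1.norm_tens, Ell1.norm_tens, norm_star, mul_assoc]

/-- A character at `k - l + m` factors as `e_k \bar e_l e_m`, so the triple sum is a product of
three absolutely convergent series. This identifies the interaction on coefficients with `|u|² u`.
-/
theorem synth_cub (a : Ell1 (Fin d → ℤ)) (x : Torus d) :
    synth (Ell1.push outFreq (cub a a a)) x = ((‖synth a x‖ ^ 2 : ℝ) : ℂ) * synth a x := by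
  have h1 : synth (Ell1.push outFreq (cub a a a)) x
      = ∑' y, cub a a a y * character (outFreq y) x := by
    have := Ell1.total_push outFreq (Ell1.mulW (C := 1) (fun y => character (outFreq y) x)
      (fun y => (norm_character _ x).le) (cub a a a))
    rw [← Ell1.mulW_push outFreq (fun j => character j x) fun j => (norm_character _ x).le] at this
    simpa [Ell1.total_apply, synth, mul_comm] using this
  have hs := summable_norm_mul_character a x
  have hs' : Summable fun j => ‖star (a j * character j x)‖ := by simpa using hs
  have h3 := tsum_mul_tsum_of_summable_norm hs' hs
  have h4 := tsum_mul_tsum_of_summable_norm hs (hs'.mul_norm hs)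
  rw [← h3, ← tsum_star] at h4
  rw [h1]
  calc ∑' y, cub a a a y * character (outFreq y) x
      = synth a x * (star (synth a x) * synth a x) := by
        simp only [synth]
        rw [h4]
        refine tsum_congr fun y => ?_
        rw [cub_apply, outFreq, sub_eq_add_neg, character_add, character_add, character_neg,
          star_mul]
        ring
    _ = _ := by
        rw [Complex.star_def, ← Complex.normSq_eq_conj_mul_self, Complex.normSq_eq_norm_sq]
        ring

end Synth

/-! ### Smooth test functions and integration by parts on the torus -/

section Smooth

variable {d : ℕ}

/-- The covering map of the torus. -/
def cover (y : Fin d → ℝ) : Torus d := fun i => (y i : AddCircle (2 * Real.pi))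

theorem isOpenQuotientMap_cover : IsOpenQuotientMap (cover (d := d)) :=
  IsOpenQuotientMap.piMap fun _ => QuotientAddGroup.isOpenQuotientMap_mk

theorem IsSmooth.continuous {φ : Torus d → ℂ} (h : IsSmooth φ) : Continuous φ :=
  isOpenQuotientMap_cover.isQuotientMap.continuous_iff.2 (ContDiff.continuous h)

theorem cover_add_single (y : Fin d → ℝ) (i : Fin d) (s : ℝ) :
    cover y + Pi.single i (s : AddCircle (2 * Real.pi)) = cover (y + Pi.single i s) := by
  ext k
  rcases eq_or_ne k i with rfl | hk
  · simp [cover]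
  · simp [cover, hk]

/-- The partial derivative along the `i`-th coordinate. -/
def partialDeriv (i : Fin d) (φ : Torus d → ℂ) (x : Torus d) : ℂ :=
  deriv (fun s : ℝ => φ (x + Pi.single i (s : AddCircle (2 * Real.pi)))) 0

theorem IsSmooth.hasDerivAt_cover {φ : Torus d → ℂ} (h : IsSmooth φ) (i : Fin d)
    (y : Fin d → ℝ) :
    HasDerivAt (fun s : ℝ => φ (cover y + Pi.single i (s : AddCircle (2 * Real.pi))))
      (fderiv ℝ (fun y => φ (cover y)) y (Pi.single i 1)) 0 := by
  have h1 : HasFDerivAt (fun y => φ (cover y)) (fderiv ℝ (fun y => φ (cover y)) y)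
      (y + Pi.single i (0 : ℝ)) := by
    have hd : Differentiable ℝ fun y => φ (cover y) := ContDiff.differentiable h (by simp)
    simpa using (hd y).hasFDerivAt
  have h2 : HasDerivAt (fun s : ℝ => y + Pi.single i s) (Pi.single i 1) 0 := by
    refine HasDerivAt.const_add _ (hasDerivAt_pi.2 fun k => ?_)
    rcases eq_or_ne k i with rfl | hk
    · simpa only [Pi.single_eq_same] using hasDerivAt_id' (0 : ℝ)
    · simpa [hk] using hasDerivAt_const (0 : ℝ) (0 : ℝ)
  simp only [cover_add_single]
  exact h1.comp_hasDerivAt (0 : ℝ) h2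

theorem IsSmooth.isSmooth_partialDeriv {φ : Torus d → ℂ} (h : IsSmooth φ) (i : Fin d) :
    IsSmooth (partialDeriv i φ) := by
  have : (fun y => partialDeriv i φ (cover y))
      = fun y => fderiv ℝ (fun y => φ (cover y)) y (Pi.single i 1) :=
    funext fun y => (h.hasDerivAt_cover i y).deriv
  change ContDiff ℝ ∞ fun y => partialDeriv i φ (cover y)
  rw [this]
  exact (ContDiff.fderiv_right (m := ∞) h (by simp)).clm_apply contDiff_const

theorem IsSmooth.hasDerivAt {φ : Torus d → ℂ} (h : IsSmooth φ) (i : Fin d) (x : Torus d) (s : ℝ) :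
    HasDerivAt (fun s : ℝ => φ (x + Pi.single i (s : AddCircle (2 * Real.pi))))
      (partialDeriv i φ (x + Pi.single i (s : AddCircle (2 * Real.pi)))) s := by
  obtain ⟨y, hy⟩ := isOpenQuotientMap_cover.surjective
    (x + Pi.single i (s : AddCircle (2 * Real.pi)))
  have h0 := h.hasDerivAt_cover i y
  have h1 := h0.differentiableAt.hasDerivAt
  rw [hy] at h1
  have h2 := HasDerivAt.comp_sub_const (f := fun s' : ℝ =>
    φ (x + Pi.single i (s : AddCircle (2 * Real.pi)) + Pi.single i (s' : AddCircle (2 * Real.pi))))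
    s s (by rw [sub_self]; exact h1)
  refine h2.congr_of_eventuallyEq (Eventually.of_forall fun t => ?_)
  simp [add_assoc, ← Pi.single_add]

theorem IsSmooth.laplacian_eq {φ : Torus d → ℂ} (h : IsSmooth φ) (x : Torus d) :
    laplacian φ x = ∑ i, partialDeriv i (partialDeriv i φ) x := by
  refine Finset.sum_congr rfl fun i _ => ?_
  rw [iteratedDeriv_succ, iteratedDeriv_one]
  have : deriv (fun s : ℝ => φ (x + Pi.single i (s : AddCircle (2 * Real.pi))))
      = fun s : ℝ => partialDeriv i φ (x + Pi.single i (s : AddCircle (2 * Real.pi))) :=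
    funext fun s => (h.hasDerivAt i x s).deriv
  rw [this]
  rfl

theorem IsSmooth.continuous_laplacian {φ : Torus d → ℂ} (h : IsSmooth φ) :
    Continuous (laplacian φ) := by
  rw [funext h.laplacian_eq]
  exact continuous_finsetSum _ fun i _ =>
    ((h.isSmooth_partialDeriv i).isSmooth_partialDeriv i).continuous

/-- Translation invariance of the measure. Differentiating this identity at `s = 0` is the
integration by parts used below. -/
theorem pairing_translate (φ : Torus d → ℂ) (i : Fin d) (j : Fin d → ℤ) (s : ℝ) :
    ∫ x, character j x * φ (x + Pi.single i (s : AddCircle (2 * Real.pi))) ∂(torusMeasure d)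
      = Complex.exp (-(Complex.I * j i * s)) * pairing φ j := by
  rw [pairing, ← integral_const_mul, ← integral_add_right_eq_self
    (fun x => Complex.exp (-(Complex.I * j i * s)) * (character j x * φ x))
    (Pi.single i (s : AddCircle (2 * Real.pi)))]
  refine integral_congr_ae (Eventually.of_forall fun x => ?_)
  simp only
  rw [character_apply_add, character_single]
  have : Complex.exp (-(Complex.I * j i * s)) * Complex.exp (Complex.I * j i * s) = 1 := by
    rw [← Complex.exp_add, neg_add_cancel, Complex.exp_zero]
  linear_combination -(character j x * φ (x + Pi.single i (s : AddCircle (2 * Real.pi)))) * this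

theorem hasDerivAt_integral_of_bounded {G G' : ℝ → Torus d → ℂ} {M : ℝ}
    (hG : ∀ s, Continuous (G s)) (hG' : ∀ s, Continuous (G' s)) (hM : ∀ s x, ‖G' s x‖ ≤ M)
    (hd : ∀ x s, HasDerivAt (fun s => G s x) (G' s x) s) (s : ℝ) :
    HasDerivAt (fun s => ∫ x, G s x ∂(torusMeasure d)) (∫ x, G' s x ∂(torusMeasure d)) s :=
  (hasDerivAt_integral_of_dominated_loc_of_deriv_le (bound := fun _ => M) univ_mem
    (Eventually.of_forall fun s => (hG s).aestronglyMeasurable)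
    (integrable_of_continuous (hG s)) (hG' s).aestronglyMeasurable
    (Eventually.of_forall fun x s _ => hM s x) (integrable_const _)
    (Eventually.of_forall fun x s _ => hd x s)).2

theorem IsSmooth.hasDerivAt_integral {φ : Torus d → ℂ} (h : IsSmooth φ) (i : Fin d)
    (j : Fin d → ℤ) :
    HasDerivAt (fun s : ℝ => ∫ x, character j x *
      φ (x + Pi.single i (s : AddCircle (2 * Real.pi))) ∂(torusMeasure d))
      (pairing (partialDeriv i φ) j) 0 := by
  have hc := h.continuous
  have hc' := (h.isSmooth_partialDeriv i).continuous
  have hj := continuous_character j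
  obtain ⟨M, hM⟩ := isCompact_univ.exists_bound_of_continuousOn hc'.continuousOn
  have h3 := hasDerivAt_integral_of_bounded
    (G := fun (s : ℝ) x => character j x * φ (x + Pi.single i (s : AddCircle (2 * Real.pi))))
    (G' := fun s x => character j x *
      partialDeriv i φ (x + Pi.single i (s : AddCircle (2 * Real.pi))))
    (fun s => hj.mul (hc.comp (continuous_id.add continuous_const)))
    (fun s => hj.mul (hc'.comp (continuous_id.add continuous_const)))
    (fun s x => by rw [norm_mul, norm_character, one_mul]; exact hM _ (mem_univ _))
    (fun x s => (h.hasDerivAt i x s).const_mul _) 0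
  have h0 : (Pi.single i ((0 : ℝ) : AddCircle (2 * Real.pi)) : Torus d) = 0 := by
    rw [AddCircle.coe_zero, Pi.single_zero]
  simp only [h0, add_zero] at h3
  exact h3

theorem IsSmooth.pairing_partialDeriv {φ : Torus d → ℂ} (h : IsSmooth φ) (i : Fin d)
    (j : Fin d → ℤ) :
    pairing (partialDeriv i φ) j = -(Complex.I * j i) * pairing φ j := by
  have h1 : HasDerivAt (fun s : ℝ => Complex.exp (-(Complex.I * j i * s)) * pairing φ j)
      (-(Complex.I * j i) * pairing φ j) 0 := by
    have h2 : HasDerivAt (fun s : ℂ => Complex.exp (-(Complex.I * j i * s)))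
        (Complex.exp (-(Complex.I * j i * (0 : ℝ))) * -(Complex.I * j i * 1)) ((0 : ℝ) : ℂ) :=
      ((hasDerivAt_id' _).const_mul _).fun_neg.cexp
    have h3 := h2.comp_ofReal.mul_const (pairing φ j)
    simpa only [Complex.ofReal_zero, mul_zero, neg_zero, Complex.exp_zero, one_mul, mul_one]
      using h3
  have h2 := h.hasDerivAt_integral i j
  simp only [pairing_translate] at h2
  exact h2.unique h1

theorem IsSmooth.pairing_laplacian {φ : Torus d → ℂ} (h : IsSmooth φ) (j : Fin d → ℤ) :
    pairing (laplacian φ) j = -(normSq j : ℂ) * pairing φ j := by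
  have h1 : pairing (laplacian φ) j
      = ∑ i, pairing (partialDeriv i (partialDeriv i φ)) j := by
    simp only [pairing, h.laplacian_eq, Finset.mul_sum]
    refine integral_finsetSum _ fun i _ => integrable_of_continuous ?_
    exact (continuous_character j).mul
      ((h.isSmooth_partialDeriv i).isSmooth_partialDeriv i).continuous
  rw [h1, normSq, Nat.cast_sum, ← Finset.sum_neg_distrib, Finset.sum_mul]
  refine Finset.sum_congr rfl fun i _ => ?_
  rw [(h.isSmooth_partialDeriv i).pairing_partialDeriv, h.pairing_partialDeriv]
  have : (((j i).natAbs ^ 2 : ℕ) : ℂ) = (j i : ℂ) ^ 2 := by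
    rw [← Int.cast_natCast]; push_cast [Int.natAbs_sq]
    norm_cast
    simp
  rw [this]
  linear_combination (j i : ℂ) ^ 2 * pairing φ j * Complex.I_sq

theorem isSmooth_character (j : Fin d → ℤ) : IsSmooth (character j) := by
  unfold IsSmooth character
  simp only [fourier_two_pi]
  refine contDiff_prod fun i _ => ?_
  have h : ContDiff ℝ ∞ fun y : Fin d → ℝ => ((y i : ℝ) : ℂ) :=
    Complex.ofRealCLM.contDiff.comp (contDiff_apply ℝ ℝ i)
  exact (contDiff_const.mul h).cexp

theorem partialDeriv_character (i : Fin d) (j : Fin d → ℤ) (c : ℂ) (x : Torus d) :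
    partialDeriv i (fun x => c * character j x) x = c * (Complex.I * j i) * character j x := by
  unfold partialDeriv
  simp only [character_apply_add, character_single]
  have h2 : HasDerivAt (fun s : ℂ => c * (character j x * Complex.exp (Complex.I * j i * s)))
      (c * (character j x * (Complex.exp (Complex.I * j i * (0 : ℝ)) * (Complex.I * j i * 1))))
      ((0 : ℝ) : ℂ) :=
    (((hasDerivAt_id _).const_mul _).cexp.const_mul _).const_mul _
  rw [h2.comp_ofReal.deriv]
  simp
  ring

theorem laplacian_character (j : Fin d → ℤ) (x : Torus d) :
    laplacian (character j) x = -(normSq j : ℂ) * character j x := by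
  rw [(isSmooth_character j).laplacian_eq, normSq, Nat.cast_sum, ← Finset.sum_neg_distrib,
    Finset.sum_mul]
  refine Finset.sum_congr rfl fun i _ => ?_
  have h1 : partialDeriv i (character j) = fun x => (Complex.I * j i) * character j x :=
    funext fun x => by simpa using partialDeriv_character i j 1 x
  rw [h1, partialDeriv_character]
  have : (((j i).natAbs ^ 2 : ℕ) : ℂ) = (j i : ℂ) ^ 2 := by
    rw [← Int.cast_natCast]; push_cast [Int.natAbs_sq]
    norm_cast
    simp
  rw [this]
  linear_combination (j i : ℂ) ^ 2 * character j x * Complex.I_sq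

end Smooth

/-! ### The cubic interaction and its profile equation -/

section Interaction

variable {d : ℕ}

/-- Triples of interacting frequencies. -/
abbrev Triple (d : ℕ) : Type := (Fin d → ℤ) × (Fin d → ℤ) × (Fin d → ℤ)

theorem cub_sub_cub (a b : Ell1 (Fin d → ℤ)) :
    cub a a a - cub b b b = cub (a - b) a a + cub b (a - b) a + cub b b (a - b) := by
  simp only [cub, star_sub, map_sub, sub_apply]
  abel

theorem norm_cub_sub_cub_le {a b : Ell1 (Fin d → ℤ)} {ρ : ℝ} (ha : ‖a‖ ≤ ρ) (hb : ‖b‖ ≤ ρ) :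
    ‖cub a a a - cub b b b‖ ≤ 3 * ρ ^ 2 * ‖a - b‖ := by
  have hρ : 0 ≤ ρ := (norm_nonneg a).trans ha
  rw [cub_sub_cub]
  refine (norm_add₃_le).trans ?_
  simp only [norm_cub]
  have h1 : ‖a - b‖ * ‖a‖ * ‖a‖ ≤ ‖a - b‖ * ρ * ρ := by gcongr
  have h2 : ‖b‖ * ‖a - b‖ * ‖a‖ ≤ ρ * ‖a - b‖ * ρ := by gcongr
  have h3 : ‖b‖ * ‖b‖ * ‖a - b‖ ≤ ρ * ρ * ‖a - b‖ := by gcongr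
  linarith

theorem tendsto_cub {β : Type*} {l : Filter β} {F : β → Ell1 (Fin d → ℤ)} {a : Ell1 (Fin d → ℤ)}
    (hF : Tendsto F l (𝓝 a)) : Tendsto (fun n => cub (F n) (F n) (F n)) l (𝓝 (cub a a a)) := by
  have h : Continuous fun a : Ell1 (Fin d → ℤ) => cub a a a := by
    unfold cub
    fun_prop
  exact (h.tendsto a).comp hF

theorem hasDerivWithinAt_cub {f : ℝ → Ell1 (Fin d → ℤ)} {f' : Ell1 (Fin d → ℤ)} {s : Set ℝ}
    {t : ℝ} (hf : HasDerivWithinAt f f' s t) :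
    HasDerivWithinAt (fun τ => cub (f τ) (f τ) (f τ))
      (cub f' (f t) (f t) + cub (f t) f' (f t) + cub (f t) (f t) f') s t := by
  have h1 := Ell1.tens.hasDerivWithinAt_of_bilinear hf.star hf
  have h2 := Ell1.tens.hasDerivWithinAt_of_bilinear hf h1
  refine h2.congr_deriv ?_
  simp only [cub, map_add]
  abel

/-- The resonance modulus `|j|² - |k|² + |l|² - |m|²` with `j = k - l + m`. -/
def modulus (x : Triple d) : ℤ :=
  (normSq (outFreq x) : ℤ) - normSq x.1 + normSq x.2.1 - normSq x.2.2

/-- The cubic interaction with a weight. -/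
def nl {C : ℝ} (w : Triple d → ℂ) (hw : ∀ x, ‖w x‖ ≤ C) (a b c : Ell1 (Fin d → ℤ)) :
    Ell1 (Fin d → ℤ) :=
  Ell1.push outFreq (Ell1.mulW w hw (cub a b c))

theorem norm_nl_le {C : ℝ} (w : Triple d → ℂ) (hw : ∀ x, ‖w x‖ ≤ C) (a b c : Ell1 (Fin d → ℤ)) :
    ‖nl w hw a b c‖ ≤ C * (‖a‖ * ‖b‖ * ‖c‖) := by
  rw [← norm_cub]
  exact (Ell1.norm_push_le _ _).trans (Ell1.norm_mulW_le _ _ _)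

theorem norm_nl_sub_nl_le (w : Triple d → ℂ) (hw : ∀ x, ‖w x‖ ≤ 1) {a b : Ell1 (Fin d → ℤ)}
    {ρ : ℝ} (ha : ‖a‖ ≤ ρ) (hb : ‖b‖ ≤ ρ) :
    ‖nl w hw a a a - nl w hw b b b‖ ≤ 3 * ρ ^ 2 * ‖a - b‖ := by
  rw [nl, nl, ← map_sub, ← map_sub]
  refine (Ell1.norm_push_le _ _).trans ((Ell1.norm_mulW_le _ _ _).trans ?_)
  rw [one_mul]
  exact norm_cub_sub_cub_le ha hb

theorem tendsto_nl {β : Type*} {l : Filter β} {C : ℝ} {w : β → Triple d → ℂ} {v : Triple d → ℂ}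
    (hw : ∀ n x, ‖w n x‖ ≤ C) (hv : ∀ x, ‖v x‖ ≤ C)
    (h : ∀ x, Tendsto (fun n => w n x) l (𝓝 (v x))) {F : β → Ell1 (Fin d → ℤ)}
    {a : Ell1 (Fin d → ℤ)} (hF : Tendsto F l (𝓝 a)) :
    Tendsto (fun n => nl (w n) (hw n) (F n) (F n) (F n)) l (𝓝 (nl v hv a a a)) :=
  ((Ell1.push outFreq).continuous.tendsto _).comp
    (Ell1.tendsto_mulW hw hv h (tendsto_cub hF))

/-- The oscillating factor `exp (i t ω)`. -/
def rot (t : ℝ) (x : Triple d) : ℂ := Complex.exp (Complex.I * t * modulus x)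

theorem norm_rot (t : ℝ) (x : Triple d) : ‖rot t x‖ = 1 := by
  have : Complex.I * t * modulus x = ((t * modulus x : ℝ) : ℂ) * Complex.I := by push_cast; ring
  rw [rot, this, Complex.norm_exp_ofReal_mul_I]

theorem continuous_rot (x : Triple d) : Continuous fun t => rot t x := by
  unfold rot; fun_prop

theorem hasDerivAt_rot (x : Triple d) (t : ℝ) :
    HasDerivAt (fun t => rot t x) (Complex.I * modulus x * rot t x) t := by
  have h2 : HasDerivAt (fun s : ℂ => Complex.exp (Complex.I * s * modulus x))
      (Complex.exp (Complex.I * (t : ℂ) * modulus x) * (Complex.I * 1 * modulus x)) (t : ℂ) :=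
    (((hasDerivAt_id' _).const_mul _).mul_const _).cexp
  refine h2.comp_ofReal.congr_deriv ?_
  simp only [rot]; ring

/-- The weight of the complete profile equation. -/
def fullW (lam t : ℝ) (x : Triple d) : ℂ := -(Complex.I * lam) * rot t x

/-- The weight of the resonant profile equation. -/
def resW (lam : ℝ) (x : Triple d) : ℂ := if modulus x = 0 then -(Complex.I * lam) else 0

/-- The primitive in time of the nonresonant part of `fullW`. -/
def primW (lam t : ℝ) (x : Triple d) : ℂ :=
  if modulus x = 0 then 0 else -lam * rot t x / modulus x

theorem norm_fullW {lam : ℝ} (hlam : |lam| = 1) (t : ℝ) (x : Triple d) : ‖fullW lam t x‖ ≤ 1 := by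
  simp [fullW, norm_rot, hlam]

theorem norm_resW {lam : ℝ} (hlam : |lam| = 1) (x : Triple d) : ‖resW lam x‖ ≤ 1 := by
  unfold resW; split_ifs <;> simp [hlam]

/-- The modulus is an integer, so dividing by it when nonzero does not increase the weight. This
absence of small divisors makes the averaging error `O(ε)`. -/
theorem norm_primW {lam : ℝ} (hlam : |lam| = 1) (t : ℝ) (x : Triple d) : ‖primW lam t x‖ ≤ 1 := by
  unfold primW
  split_ifs with h
  · simp
  · have h1 : (1 : ℝ) ≤ ‖(modulus x : ℂ)‖ := by
      rw [Complex.norm_intCast]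
      exact_mod_cast Int.one_le_abs h
    rw [norm_div, norm_mul, norm_rot, norm_neg, Complex.norm_real, Real.norm_eq_abs, hlam, one_mul]
    exact (div_le_one (by linarith)).2 h1

/-- On resonant triples the two weights coincide, hence the bound 1 rather than 2. -/
theorem norm_fullW_sub_resW {lam : ℝ} (hlam : |lam| = 1) (t : ℝ) (x : Triple d) :
    ‖fullW lam t x - resW lam x‖ ≤ 1 := by
  unfold resW
  split_ifs with h
  · simp [fullW, rot, h]
  · simpa using norm_fullW hlam t x

theorem continuous_fullW (lam : ℝ) (x : Triple d) : Continuous fun t => fullW lam t x :=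
  continuous_const.mul (continuous_rot x)

theorem hasDerivAt_primW (lam t : ℝ) (x : Triple d) :
    HasDerivAt (fun t => primW lam t x) (fullW lam t x - resW lam x) t := by
  unfold primW fullW resW
  split_ifs with h
  · simpa [rot, h] using hasDerivAt_const t (0 : ℂ)
  · refine (((hasDerivAt_rot x t).const_mul (-lam : ℂ)).div_const (modulus x : ℂ)).congr_deriv ?_
    have : (modulus x : ℂ) ≠ 0 := by exact_mod_cast h
    field_simp
    ring

end Interaction

/-! ### Local existence of the profile -/

section Picard

open Metric Function

/-- Picard–Lindelöf, with the solution staying in the ball. -/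
theorem exists_hasDerivWithinAt_mem_closedBall {E : Type*} [NormedAddCommGroup E]
    [NormedSpace ℝ E] [CompleteSpace E] {f : ℝ → E → E} {T : ℝ} (hT : 0 ≤ T) {x₀ : E}
    {a L K : NNReal} (hf : IsPicardLindelof f (⟨0, le_rfl, hT⟩ : Icc (0 : ℝ) T) x₀ a 0 L K) :
    ∃ α : ℝ → E, α 0 = x₀ ∧ ∀ t ∈ Icc (0 : ℝ) T, α t ∈ closedBall x₀ a ∧
      HasDerivWithinAt α (f t (α t)) (Icc 0 T) t := by
  -- The fixed point of the Picard map lives in a space of Lipschitz curves, whose values stay in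
  -- the ball; working with it directly retains this information.
  obtain ⟨α, hα⟩ := ODE.FunSpace.exists_isFixedPt_next hf (mem_closedBall_self le_rfl)
  refine ⟨α.compProj, ?_, fun t ht => ⟨α.compProj_mem_closedBall hf.mul_max_le, ?_⟩⟩
  · have := ODE.FunSpace.compProj_val (α := α) (t := (⟨0, le_rfl, hT⟩ : Icc (0 : ℝ) T))
    rw [← hα, ODE.FunSpace.next_apply₀] at this
    rw [← hα]; exact this
  · apply ODE.hasDerivWithinAt_picard_Icc (⟨le_rfl, hT⟩ : (0 : ℝ) ∈ Icc 0 T) hf.continuousOn_uncurry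
      α.continuous_compProj.continuousOn (fun _ ht' => α.compProj_mem_closedBall hf.mul_max_le)
      x₀ ht |>.congr_of_mem _ ht
    intro t' ht'
    nth_rw 1 [← hα]
    rw [ODE.FunSpace.compProj_of_mem ht', ODE.FunSpace.next_apply]

/-- Existence of the profile, with the initial norm at most five, on the slow time
interval `[0, 1/400]`. -/
theorem exists_profile {d : ℕ} {lam : ℝ} (hlam : |lam| = 1) (ε : ℝ) {x₀ : Ell1 (Fin d → ℤ)}
    (hx₀ : ‖x₀‖ ≤ 5) :
    ∃ b : ℝ → Ell1 (Fin d → ℤ), b 0 = x₀ ∧ ∀ τ ∈ Icc (0 : ℝ) (1 / 400), ‖b τ‖ ≤ 10 ∧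
      HasDerivWithinAt b (nl (fullW lam (τ / ε)) (norm_fullW hlam _) (b τ) (b τ) (b τ))
        (Icc 0 (1 / 400)) τ := by
  have hball : ∀ x ∈ closedBall x₀ (5 : NNReal), ‖x‖ ≤ 10 := fun x hx => by
    have h := mem_closedBall_iff_norm.1 hx
    have h' := norm_le_norm_add_norm_sub' x x₀
    norm_num at h
    linarith
  -- On the ball of radius 5 about `x₀` norms are at most 10, so the field is bounded by `10³ =
  -- 1000` and has Lipschitz constant `3 · 10² = 300`. The time `1/400` is admissible because `1000
  -- / 400 ≤ 5`.
  have hpl : IsPicardLindelof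
      (fun τ (x : Ell1 (Fin d → ℤ)) => nl (fullW lam (τ / ε)) (norm_fullW hlam _) x x x)
      (⟨0, le_rfl, by norm_num⟩ : Icc (0 : ℝ) (1 / 400)) x₀ 5 0 1000 300 := by
    refine ⟨fun τ _ => LipschitzOnWith.of_dist_le_mul fun x hx y hy => ?_, fun x _ => ?_,
      fun τ _ x hx => ?_, ?_⟩
    · rw [dist_eq_norm, dist_eq_norm]
      refine (norm_nl_sub_nl_le _ _ (hball x hx) (hball y hy)).trans (le_of_eq ?_)
      norm_num
    · refine Continuous.continuousOn (continuous_iff_continuousAt.2 fun τ => ?_)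
      refine tendsto_nl (fun _ => norm_fullW hlam _) (norm_fullW hlam _) (fun y => ?_)
        tendsto_const_nhds
      exact ((continuous_fullW lam y).comp (continuous_id.div_const ε)).tendsto τ
    · refine (norm_nl_le _ _ _ _ _).trans ?_
      have := hball x hx
      calc 1 * (‖x‖ * ‖x‖ * ‖x‖) ≤ 1 * (10 * 10 * 10) := by gcongr
        _ = _ := by norm_num
    · norm_num
  obtain ⟨b, h0, hb⟩ := exists_hasDerivWithinAt_mem_closedBall (by norm_num) hpl
  exact ⟨b, h0, fun τ hτ => ⟨hball _ (hb τ hτ).1, (hb τ hτ).2⟩⟩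

end Picard

/-! ### Equivalence of the equation with the profile equation -/

section Phase

variable {d : ℕ}

/-- The free phase `exp (-i t |j|²)`. -/
def phase (t : ℝ) (j : Fin d → ℤ) : ℂ := Complex.exp (-(Complex.I * (t : ℂ) * (normSq j : ℂ)))

theorem norm_phase (t : ℝ) (j : Fin d → ℤ) : ‖phase t j‖ = 1 := by
  have : -(Complex.I * (t : ℂ) * (normSq j : ℂ)) = ((-(t * normSq j) : ℝ) : ℂ) * Complex.I := by
    push_cast; ring
  rw [phase, this, Complex.norm_exp_ofReal_mul_I]

theorem phase_zero (j : Fin d → ℤ) : phase 0 j = 1 := by simp [phase]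

theorem phase_mul_phase_neg (t : ℝ) (j : Fin d → ℤ) : phase t j * phase (-t) j = 1 := by
  rw [phase, phase, ← Complex.exp_add]; simp

theorem hasDerivAt_phase (j : Fin d → ℤ) (t : ℝ) :
    HasDerivAt (fun t => phase t j) (-(Complex.I * normSq j) * phase t j) t := by
  have h2 : HasDerivAt (fun s : ℂ => Complex.exp (-(Complex.I * s * (normSq j : ℂ))))
      (Complex.exp (-(Complex.I * (t : ℂ) * (normSq j : ℂ))) *
        -(Complex.I * 1 * (normSq j : ℂ))) (t : ℂ) :=
    (((hasDerivAt_id' _).const_mul _).mul_const _).fun_neg.cexp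
  refine h2.comp_ofReal.congr_deriv ?_
  simp only [phase]; ring

/-- The free Schrödinger flow on Fourier coefficients. -/
def flow (t : ℝ) (a : Ell1 (Fin d → ℤ)) : Ell1 (Fin d → ℤ) :=
  Ell1.mulW (phase t) (fun j => (norm_phase t j).le) a

theorem flow_apply (t : ℝ) (a : Ell1 (Fin d → ℤ)) (j : Fin d → ℤ) :
    flow t a j = phase t j * a j := rfl

theorem flow_flow_neg (t : ℝ) (a : Ell1 (Fin d → ℤ)) : flow t (flow (-t) a) = a :=
  Ell1.ext' fun j => by rw [flow_apply, flow_apply, ← mul_assoc, phase_mul_phase_neg, one_mul]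

/-- Passing to the profile removes the Laplacian and leaves exactly the factor `e^{itω}` in each
interaction. -/
theorem phase_outFreq (t : ℝ) (x : Triple d) :
    phase t (outFreq x) * rot t x = phase t x.1 * (star (phase t x.2.1) * phase t x.2.2) := by
  have : star (phase t x.2.1) = phase (-t) x.2.1 := by
    rw [phase, Complex.star_def, ← Complex.exp_conj, phase]
    simp
  rw [this, phase, phase, phase, phase, rot, ← Complex.exp_add, ← Complex.exp_add,
    ← Complex.exp_add, modulus]
  congr 1
  push_cast
  ring

theorem phase_mul_nl {lam : ℝ} (hlam : |lam| = 1) (t : ℝ) (a : Ell1 (Fin d → ℤ))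
    (j : Fin d → ℤ) :
    phase t j * nl (fullW lam t) (norm_fullW hlam t) a a a j
      = -(Complex.I * lam) * Ell1.push outFreq (cub (flow t a) (flow t a) (flow t a)) j := by
  rw [nl, Ell1.push_apply, Ell1.push_apply, ← tsum_mul_left, ← tsum_mul_left]
  refine tsum_congr fun x => ?_
  split_ifs with h
  · subst h
    have := phase_outFreq t x
    rw [Ell1.mulW_apply, cub_apply, cub_apply, flow_apply, flow_apply, flow_apply, fullW, star_mul]
    linear_combination (-(Complex.I * lam) * (a x.1 * (star (a x.2.1) * a x.2.2))) * this
  · simp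

theorem norm_pairing_le {φ : Torus d → ℂ} {M : ℝ} (hM : ∀ x, ‖φ x‖ ≤ M) (j : Fin d → ℤ) :
    ‖pairing φ j‖ ≤ M := by
  have := norm_integral_le_of_norm_le_const (μ := torusMeasure d)
    (f := fun x => character j x * φ x) (C := M)
    (Eventually.of_forall fun x => by rw [norm_mul, norm_character, one_mul]; exact hM x)
  rwa [probReal_univ, mul_one] at this

end Phase

/-! ### From a profile to a weak solution -/

section Existence

variable {d : ℕ}

theorem continuousInWiener_synth {τ : ℝ} {V : ℝ → Ell1 (Fin d → ℤ)}
    (hV : ContinuousOn V (Icc 0 τ)) : ContinuousInWiener τ fun t => synth (V t) := by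
  refine ⟨fun t _ => isWiener_iff.2 ⟨_, rfl⟩, fun t ht => ?_⟩
  simp only [← synth_sub, wienerNorm_synth]
  exact tendsto_iff_norm_sub_tendsto_zero.1 (hV t ht)

theorem tendsto_flow {β : Type*} {l : Filter β} {s : β → ℝ} {t : ℝ} (hs : Tendsto s l (𝓝 t))
    {F : β → Ell1 (Fin d → ℤ)} {a : Ell1 (Fin d → ℤ)} (hF : Tendsto F l (𝓝 a)) :
    Tendsto (fun n => flow (s n) (F n)) l (𝓝 (flow t a)) :=
  Ell1.tendsto_mulW (fun _ j => (norm_phase _ j).le) (fun j => (norm_phase _ j).le)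
    (fun j => ((hasDerivAt_phase j t).continuousAt.tendsto).comp hs) hF

/-- A solution of the profile equation provides a solution of the equation. -/
theorem isNLSSolution_synth_flow {lam ε τ : ℝ} (hlam : |lam| = 1) {a : ℝ → Ell1 (Fin d → ℤ)}
    (ha : ∀ t ∈ Icc 0 τ, HasDerivWithinAt a
      (ε • nl (fullW lam t) (norm_fullW hlam t) (a t) (a t) (a t)) (Icc 0 τ) t) :
    IsNLSSolution (lam * ε) (synth (a 0)) τ fun t => synth (flow t (a t)) where
  continuous := continuousInWiener_synth fun t ht =>
    tendsto_flow (tendsto_nhdsWithin_of_tendsto_nhds tendsto_id) (ha t ht).continuousWithinAt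
  initial := by
    congr 1
    exact Ell1.ext' fun j => by rw [flow_apply, phase_zero, one_mul]
  equation φ hφ t ht := by
    obtain ⟨M, hM⟩ := isCompact_univ.exists_bound_of_continuousOn hφ.continuous.continuousOn
    obtain ⟨M', hM'⟩ := isCompact_univ.exists_bound_of_continuousOn
      hφ.continuous_laplacian.continuousOn
    set C := max M M'
    have hw : ∀ (s : ℝ) (j : Fin d → ℤ), ‖phase s j * pairing φ j‖ ≤ C := fun s j => by
      rw [norm_mul, norm_phase, one_mul]
      exact (norm_pairing_le (fun x => hM x (mem_univ x)) j).trans (le_max_left _ _)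
    -- The phases have unbounded derivatives `-i|j|²`, but paired with a smooth `φ` the factor
    -- `-|j|²` moves to `Δφ`, which is bounded. This makes the weighted product rule applicable.
    have hw' : ∀ (s : ℝ) (j : Fin d → ℤ),
        ‖Complex.I * (phase s j * pairing (laplacian φ) j)‖ ≤ C := fun s j => by
      rw [norm_mul, norm_mul, norm_phase, one_mul, Complex.norm_I, one_mul]
      exact (norm_pairing_le (fun x => hM' x (mem_univ x)) j).trans (le_max_right _ _)
    have h1 := Ell1.hasDerivWithinAt_mulW hw hw' (fun s j => by
      refine ((hasDerivAt_phase j s).mul_const (pairing φ j)).congr_deriv ?_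
      rw [hφ.pairing_laplacian]; ring) (ha t ht)
    have h2 := ((Ell1.total.hasFDerivAt.comp_hasDerivWithinAt t h1).const_mul Complex.I)
    have e1 : ∀ s, ∫ x, synth (flow s (a s)) x * φ x ∂(torusMeasure d)
        = Ell1.total (Ell1.mulW (fun j => phase s j * pairing φ j) (hw s) (a s)) := fun s => by
      rw [← (hasSum_integral_synth_mul _ hφ.continuous).tsum_eq, Ell1.total_apply]
      refine tsum_congr fun j => ?_
      rw [flow_apply, Ell1.mulW_apply]; ring
    simp only [e1]
    refine h2.congr_deriv ?_
    have e2 : Complex.I * Ell1.total (Ell1.mulW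
          (fun j => Complex.I * (phase t j * pairing (laplacian φ) j)) (hw' t) (a t))
        = -∫ x, synth (flow t (a t)) x * laplacian φ x ∂(torusMeasure d) := by
      rw [← (hasSum_integral_synth_mul _ hφ.continuous_laplacian).tsum_eq, Ell1.total_apply,
        ← tsum_mul_left, ← tsum_neg]
      refine tsum_congr fun j => ?_
      rw [flow_apply, Ell1.mulW_apply]
      linear_combination (phase t j * pairing (laplacian φ) j * a t j) * Complex.I_sq
    have e3 : Complex.I * Ell1.total (Ell1.mulW (fun j => phase t j * pairing φ j) (hw t)
          (ε • nl (fullW lam t) (norm_fullW hlam t) (a t) (a t) (a t)))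
        = ((lam * ε : ℝ) : ℂ) * ∫ x, ((‖synth (flow t (a t)) x‖ ^ 2 : ℝ) : ℂ) *
            synth (flow t (a t)) x * φ x ∂(torusMeasure d) := by
      simp only [← synth_cub]
      rw [← (hasSum_integral_synth_mul _ hφ.continuous).tsum_eq, Ell1.total_apply,
        ← tsum_mul_left, ← tsum_mul_left]
      refine tsum_congr fun j => ?_
      have := phase_mul_nl hlam t (a t) j
      rw [Ell1.mulW_apply, Ell1.smul_apply', Complex.real_smul]
      push_cast
      linear_combination (Complex.I * ε * pairing φ j) * this -
        (lam * ε * pairing φ j *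
          Ell1.push outFreq (cub (flow t (a t)) (flow t (a t)) (flow t (a t))) j) * Complex.I_sq
    rw [map_add, mul_add, e2, e3]
    ring

end Existence

/-! ### From a weak solution to a profile, and uniqueness -/

section Uniqueness

variable {d : ℕ}

theorem hasDerivWithinAt_Ici_of_Icc {E : Type*} [NormedAddCommGroup E] [NormedSpace ℝ E]
    {f : ℝ → E} {f' : E} {a b t : ℝ} (h : HasDerivWithinAt f f' (Icc a b) t) (ht : t ∈ Ico a b) :
    HasDerivWithinAt f f' (Ici t) t :=
  h.mono_of_mem_nhdsWithin (Icc_mem_nhdsGE_of_mem ht)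

/-- Testing the equation yields derivatives of single coefficients only. Continuity of the candidate
derivative `g` in `ℓ¹` upgrades them to a derivative in norm. -/
theorem hasDerivWithinAt_of_eval {κ : Type*} {τ : ℝ} {a g : ℝ → Ell1 κ}
    (hg : ContinuousOn g (Icc 0 τ))
    (ha : ∀ i, ∀ t ∈ Icc 0 τ, HasDerivWithinAt (fun s => a s i) (g t i) (Icc 0 τ) t) :
    ∀ t ∈ Icc 0 τ, HasDerivWithinAt a (g t) (Icc 0 τ) t := by
  intro t ht
  have h0 : (0 : ℝ) ∈ Icc 0 τ := ⟨le_rfl, ht.1.trans ht.2⟩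
  -- `A` is `a 0` plus the integral of `g`: the Picard operator for a field that ignores the state.
  -- Each coefficient of `a - A` has zero derivative and starts at zero.
  set A := ODE.picard (fun s (_ : Ell1 κ) => g s) 0 (a 0) a with hA
  have hderiv : ∀ s ∈ Icc 0 τ, HasDerivWithinAt A (g s) (Icc 0 τ) s := fun s hs =>
    ODE.hasDerivWithinAt_picard_Icc (f := fun s (_ : Ell1 κ) => g s) (u := univ)
      (α := fun _ => a 0) h0
      (hg.comp (f := fun p : ℝ × Ell1 κ => p.1) continuousOn_fst fun _ hx => hx.1)
      continuousOn_const (fun _ _ => mem_univ _) (a 0) hs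
  have heq : ∀ s ∈ Icc 0 τ, a s = A s := fun s hs => Ell1.ext' fun i => by
    have hz : ∀ r ∈ Icc 0 τ, HasDerivWithinAt (fun r => a r i - A r i) 0 (Icc 0 τ) r :=
        fun r hr => by
      have h1 : HasDerivWithinAt (fun r => A r i) (g r i) (Icc 0 τ) r :=
        (Ell1.eval i).hasFDerivAt.comp_hasDerivWithinAt r (hderiv r hr)
      exact ((ha i r hr).sub h1).congr_deriv (sub_self _)
    have := (convex_Icc 0 τ).norm_image_sub_le_of_norm_hasDerivWithin_le (C := 0) hz
      (fun r _ => by simp) h0 hs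
    have hA0 : A 0 = a 0 := by simp [hA]
    simp only [hA0, sub_self, sub_zero, zero_mul, norm_le_zero_iff] at this
    exact sub_eq_zero.1 this
  exact (hderiv t ht).congr_of_mem heq ht

/-- A solution of the equation has a profile solving the profile equation. -/
theorem IsNLSSolution.exists_profile {lam ε τ : ℝ} (hlam : |lam| = 1) {u₀ : Torus d → ℂ}
    {v : ℝ → Torus d → ℂ} (hv : IsNLSSolution (lam * ε) u₀ τ v) :
    ∃ a : ℝ → Ell1 (Fin d → ℤ), (∀ t ∈ Icc 0 τ, v t = synth (flow t (a t))) ∧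
      ∀ t ∈ Icc 0 τ, HasDerivWithinAt a
        (ε • nl (fullW lam t) (norm_fullW hlam t) (a t) (a t) (a t)) (Icc 0 τ) t := by
  have hex : ∀ t, ∃ b : Ell1 (Fin d → ℤ), t ∈ Icc 0 τ → v t = synth b := fun t => by
    by_cases ht : t ∈ Icc 0 τ
    · obtain ⟨b, hb⟩ := isWiener_iff.1 (hv.continuous.1 t ht)
      exact ⟨b, fun _ => hb⟩
    · exact ⟨0, fun h => absurd h ht⟩
  choose V hV using hex
  have hVc : ContinuousOn V (Icc 0 τ) := fun t ht => by
    refine tendsto_iff_norm_sub_tendsto_zero.2 ((hv.continuous.2 t ht).congr' ?_)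
    filter_upwards [self_mem_nhdsWithin] with s hs
    rw [hV s hs, hV t ht, ← synth_sub, wienerNorm_synth]
  have hac : ContinuousOn (fun t => flow (-t) (V t)) (Icc 0 τ) := fun t ht =>
    tendsto_flow (tendsto_nhdsWithin_of_tendsto_nhds (tendsto_id.neg)) (hVc t ht)
  refine ⟨fun t => flow (-t) (V t), fun t ht => by rw [flow_flow_neg, hV t ht],
    hasDerivWithinAt_of_eval (fun t ht => ?_) fun j t ht => ?_⟩
  · exact (tendsto_nl (fun s => norm_fullW hlam s) (norm_fullW hlam t)
      (fun x => ((continuous_fullW lam x).tendsto t).mono_left nhdsWithin_le_nhds)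
      (hac t ht)).const_smul ε
  -- Testing against the character of `-j` extracts the `j`-th coefficient of each term of the
  -- equation.
  · have hpair : ∀ b : Ell1 (Fin d → ℤ),
        ∫ x, synth b x * character (-j) x ∂(torusMeasure d) = b j := coeff_synth (j := j)
    have h1 := hv.equation _ (isSmooth_character (-j)) t ht
    have hn : normSq (-j) = normSq j := by simp [normSq]
    have e1 : ∫ x, v t x * laplacian (character (-j)) x ∂(torusMeasure d)
        = -(normSq j : ℂ) * V t j := by
      simp only [laplacian_character, hn, hV t ht, ← hpair (V t), ← integral_const_mul]
      congr with x
      ring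
    have e2 : ∫ x, ((‖v t x‖ ^ 2 : ℝ) : ℂ) * v t x * character (-j) x ∂(torusMeasure d)
        = Ell1.push outFreq (cub (V t) (V t) (V t)) j := by
      simp only [hV t ht, ← synth_cub, hpair]
    rw [e1, e2] at h1
    have h2 : HasDerivWithinAt (fun s => Complex.I * V s j)
        (((lam * ε : ℝ) : ℂ) * Ell1.push outFreq (cub (V t) (V t) (V t)) j
          - -(normSq j : ℂ) * V t j) (Icc 0 τ) t := by
      refine h1.congr_of_mem (fun s hs => ?_) ht
      rw [hV s hs, hpair]
    have h3 : HasDerivWithinAt (fun s : ℝ => phase (-s) j)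
        (Complex.I * normSq j * phase (-t) j) (Icc 0 τ) t := by
      refine (((hasDerivAt_phase j (-t)).scomp t (hasDerivAt_neg t)).congr_deriv
        ?_).hasDerivWithinAt
      simp
    refine ((h3.mul (h2.const_mul (-Complex.I))).congr_deriv ?_).congr_of_mem (fun s _ => ?_) ht
    · have h4 := phase_mul_nl hlam t (flow (-t) (V t)) j
      rw [flow_flow_neg] at h4
      have h5 := phase_mul_phase_neg t j
      rw [Ell1.smul_apply', Complex.real_smul]
      push_cast
      linear_combination (-ε * phase (-t) j) * h4 +
        (ε * nl (fullW lam t) (norm_fullW hlam t) (flow (-t) (V t)) (flow (-t) (V t))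
          (flow (-t) (V t)) j) * h5 - (Complex.I * normSq j * phase (-t) j * V t j) * Complex.I_sq
    · rw [flow_apply]
      simp only [Pi.mul_apply]
      linear_combination (phase (-s) j * V s j) * Complex.I_sq

theorem profile_unique {lam ε τ : ℝ} (hlam : |lam| = 1) {a b : ℝ → Ell1 (Fin d → ℤ)}
    (ha : ∀ t ∈ Icc 0 τ, HasDerivWithinAt a
      (ε • nl (fullW lam t) (norm_fullW hlam t) (a t) (a t) (a t)) (Icc 0 τ) t)
    (hb : ∀ t ∈ Icc 0 τ, HasDerivWithinAt b
      (ε • nl (fullW lam t) (norm_fullW hlam t) (b t) (b t) (b t)) (Icc 0 τ) t)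
    (h0 : a 0 = b 0) : EqOn a b (Icc 0 τ) := by
  have hac : ContinuousOn a (Icc 0 τ) := fun t ht => (ha t ht).continuousWithinAt
  have hbc : ContinuousOn b (Icc 0 τ) := fun t ht => (hb t ht).continuousWithinAt
  obtain ⟨M, hM⟩ := isCompact_Icc.exists_bound_of_continuousOn hac
  obtain ⟨M', hM'⟩ := isCompact_Icc.exists_bound_of_continuousOn hbc
  -- The cubic field is only locally Lipschitz, so uniqueness is applied on a ball containing both
  -- compact trajectories.
  set ρ := max M M'
  refine ODE_solution_unique_of_mem_Icc_right (K := (|ε| * (3 * ρ ^ 2)).toNNReal)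
    (v := fun t x => ε • nl (fullW lam t) (norm_fullW hlam t) x x x)
    (s := fun _ => {x | ‖x‖ ≤ ρ}) (fun t _ => LipschitzOnWith.of_dist_le_mul fun x hx y hy => ?_)
    hac (fun t ht => hasDerivWithinAt_Ici_of_Icc (ha t (Ico_subset_Icc_self ht)) ht)
    (fun t ht => (hM t (Ico_subset_Icc_self ht)).trans (le_max_left _ _))
    hbc (fun t ht => hasDerivWithinAt_Ici_of_Icc (hb t (Ico_subset_Icc_self ht)) ht)
    (fun t ht => (hM' t (Ico_subset_Icc_self ht)).trans (le_max_right _ _)) h0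
  rw [dist_eq_norm, dist_eq_norm, ← smul_sub, norm_smul, Real.coe_toNNReal _ (by positivity),
    Real.norm_eq_abs, mul_assoc]
  exact mul_le_mul_of_nonneg_left (norm_nl_sub_nl_le _ _ hx hy) (abs_nonneg _)

end Uniqueness

/-! ### Power series solution of a cubic equation -/

section Series

variable {E : Type*} [NormedAddCommGroup E] [NormedSpace ℝ E]

/-- Triples of natural numbers with given sum. -/
def triples (m : ℕ) : Finset (ℕ × ℕ × ℕ) :=
  (Finset.range (m + 1) ×ˢ Finset.range (m + 1) ×ˢ Finset.range (m + 1)).filter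
    fun x => x.1 + x.2.1 + x.2.2 = m

theorem mem_triples {m : ℕ} {x : ℕ × ℕ × ℕ} : x ∈ triples m ↔ x.1 + x.2.1 + x.2.2 = m := by
  simp only [triples, Finset.mem_filter, Finset.mem_product, Finset.mem_range]
  omega

/-- The Taylor coefficients of the solution of `y' = R(y, y, y)`, `y(0) = x₀`. -/
def taylor (R : E →ₗ[ℝ] E →ₗ[ℝ] E →ₗ[ℝ] E) (x₀ : E) : ℕ → E
  | 0 => x₀
  | m + 1 => ((m + 1 : ℝ)⁻¹) • ∑ x ∈ (triples m).attach,
      R (taylor R x₀ x.1.1) (taylor R x₀ x.1.2.1) (taylor R x₀ x.1.2.2)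
  decreasing_by
    all_goals
      have := mem_triples.1 x.2
      omega

variable {R : E →ₗ[ℝ] E →ₗ[ℝ] E →ₗ[ℝ] E} {x₀ : E}

theorem taylor_zero : taylor R x₀ 0 = x₀ := by rw [taylor]

theorem taylor_succ (m : ℕ) : taylor R x₀ (m + 1) = ((m + 1 : ℝ)⁻¹) • ∑ x ∈ triples m,
    R (taylor R x₀ x.1) (taylor R x₀ x.2.1) (taylor R x₀ x.2.2) := by
  rw [taylor, Finset.sum_attach (triples m)
    fun x => R (taylor R x₀ x.1) (taylor R x₀ x.2.1) (taylor R x₀ x.2.2)]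

/-- The cube of indices below `N`. -/
def cube (N : ℕ) : Finset (ℕ × ℕ × ℕ) := Finset.range N ×ˢ Finset.range N ×ˢ Finset.range N

theorem sum_triples {F : Type*} [AddCommMonoid F] (N : ℕ) (f : ℕ × ℕ × ℕ → F) :
    ∑ m ∈ Finset.range N, ∑ x ∈ triples m, f x
      = ∑ x ∈ (cube N).filter fun x => x.1 + x.2.1 + x.2.2 < N, f x := by
  rw [← Finset.sum_fiberwise_of_maps_to (t := Finset.range N)
    (g := fun x : ℕ × ℕ × ℕ => x.1 + x.2.1 + x.2.2) (by simp)]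
  refine Finset.sum_congr rfl fun m hm => Finset.sum_congr ?_ fun _ _ => rfl
  ext x
  have := Finset.mem_range.1 hm
  simp only [mem_triples, cube, Finset.mem_filter, Finset.mem_product, Finset.mem_range]
  omega

theorem sum_cube (N : ℕ) (f g h : ℕ → ℝ) :
    ∑ x ∈ cube N, f x.1 * g x.2.1 * h x.2.2
      = (∑ m ∈ Finset.range N, f m) * (∑ m ∈ Finset.range N, g m) * ∑ m ∈ Finset.range N, h m := by
  rw [cube, Finset.sum_product, mul_assoc, Finset.sum_mul]
  refine Finset.sum_congr rfl fun p _ => ?_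
  rw [Finset.sum_product, Finset.sum_mul, Finset.mul_sum]
  refine Finset.sum_congr rfl fun q _ => ?_
  rw [Finset.mul_sum, Finset.mul_sum]
  exact Finset.sum_congr rfl fun r _ => by ring

/-- Majorant argument. Dropping the factor `1/(m+1)` in the recursion, the partial sums `A_N` of the
weighted norms satisfy `A_{N+1} ≤ 5 + A_N³ / 200`, and the bound 10 reproduces itself since `5 + 10³
/ 200 = 10`. -/
theorem sum_norm_taylor_le (hR : ∀ a b c, ‖R a b c‖ ≤ ‖a‖ * ‖b‖ * ‖c‖) (hx₀ : ‖x₀‖ ≤ 5) (N : ℕ) :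
    ∑ m ∈ Finset.range N, ‖taylor R x₀ m‖ * (1 / 200 : ℝ) ^ m ≤ 10 := by
  induction N with
  | zero => norm_num
  | succ N ih =>
    set A := ∑ m ∈ Finset.range N, ‖taylor R x₀ m‖ * (1 / 200 : ℝ) ^ m with hA
    have hA0 : 0 ≤ A := Finset.sum_nonneg fun _ _ => by positivity
    have h1 : ∀ m ∈ Finset.range N, ‖taylor R x₀ (m + 1)‖ * (1 / 200 : ℝ) ^ (m + 1)
        ≤ 1 / 200 * ∑ x ∈ triples m, (‖taylor R x₀ x.1‖ * (1 / 200 : ℝ) ^ x.1) *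
          (‖taylor R x₀ x.2.1‖ * (1 / 200 : ℝ) ^ x.2.1) *
          (‖taylor R x₀ x.2.2‖ * (1 / 200 : ℝ) ^ x.2.2) := fun m _ => by
      have h2 : ‖taylor R x₀ (m + 1)‖ ≤ ∑ x ∈ triples m,
          ‖taylor R x₀ x.1‖ * ‖taylor R x₀ x.2.1‖ * ‖taylor R x₀ x.2.2‖ := by
        rw [taylor_succ, norm_smul]
        have h3 : ‖((m + 1 : ℝ)⁻¹)‖ ≤ 1 := by
          rw [norm_inv, Real.norm_eq_abs, abs_of_pos (by positivity)]
          exact inv_le_one_of_one_le₀ (by linarith [(Nat.cast_nonneg m : (0 : ℝ) ≤ m)])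
        refine (mul_le_of_le_one_left (norm_nonneg _) h3).trans ((norm_sum_le _ _).trans ?_)
        exact Finset.sum_le_sum fun x _ => hR _ _ _
      calc ‖taylor R x₀ (m + 1)‖ * (1 / 200 : ℝ) ^ (m + 1)
          ≤ (∑ x ∈ triples m, ‖taylor R x₀ x.1‖ * ‖taylor R x₀ x.2.1‖ * ‖taylor R x₀ x.2.2‖) *
            (1 / 200 : ℝ) ^ (m + 1) := by gcongr
        _ = _ := by
          rw [Finset.sum_mul, Finset.mul_sum]
          refine Finset.sum_congr rfl fun x hx => ?_
          rw [← mem_triples.1 hx]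
          ring
    rw [Finset.sum_range_succ', pow_zero, mul_one, taylor_zero]
    have h4 := Finset.sum_le_sum h1
    rw [← Finset.mul_sum, sum_triples] at h4
    have h5 := Finset.sum_le_sum_of_subset_of_nonneg
      (Finset.filter_subset (fun x : ℕ × ℕ × ℕ => x.1 + x.2.1 + x.2.2 < N) (cube N))
      (f := fun x => (‖taylor R x₀ x.1‖ * (1 / 200 : ℝ) ^ x.1) *
          (‖taylor R x₀ x.2.1‖ * (1 / 200 : ℝ) ^ x.2.1) *
          (‖taylor R x₀ x.2.2‖ * (1 / 200 : ℝ) ^ x.2.2)) (fun _ _ _ => by positivity)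
    rw [sum_cube N (fun p => ‖taylor R x₀ p‖ * (1 / 200 : ℝ) ^ p)
      (fun p => ‖taylor R x₀ p‖ * (1 / 200 : ℝ) ^ p)
      (fun p => ‖taylor R x₀ p‖ * (1 / 200 : ℝ) ^ p), ← hA] at h5
    have h6 : A * A * A ≤ 10 * 10 * 10 := by gcongr
    linarith

/-- The Taylor polynomial. -/
def taylorPoly (R : E →ₗ[ℝ] E →ₗ[ℝ] E →ₗ[ℝ] E) (x₀ : E) (N : ℕ) (τ : ℝ) : E :=
  ∑ m ∈ Finset.range (N + 1), τ ^ m • taylor R x₀ m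

theorem taylorPoly_zero (N : ℕ) : taylorPoly R x₀ N 0 = x₀ := by
  rw [taylorPoly, Finset.sum_range_succ']
  simp [taylor_zero]

theorem sum_norm_taylor_tail_le (hR : ∀ a b c, ‖R a b c‖ ≤ ‖a‖ * ‖b‖ * ‖c‖) (hx₀ : ‖x₀‖ ≤ 5)
    (n N : ℕ) {τ : ℝ} (h0 : 0 ≤ τ) (hτ : τ ≤ 1 / 200) :
    ∑ m ∈ Finset.Ico n N, τ ^ m * ‖taylor R x₀ m‖ ≤ 10 * (200 * τ) ^ n := by
  calc ∑ m ∈ Finset.Ico n N, τ ^ m * ‖taylor R x₀ m‖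
      ≤ ∑ m ∈ Finset.Ico n N, (200 * τ) ^ n * (‖taylor R x₀ m‖ * (1 / 200 : ℝ) ^ m) := by
        refine Finset.sum_le_sum fun m hm => ?_
        have h1 : (200 * τ) ^ m ≤ (200 * τ) ^ n :=
          pow_le_pow_of_le_one (by positivity) (by linarith) (Finset.mem_Ico.1 hm).1
        calc τ ^ m * ‖taylor R x₀ m‖ = (200 * τ) ^ m * (‖taylor R x₀ m‖ * (1 / 200 : ℝ) ^ m) := by
              rw [mul_comm ‖_‖, ← mul_assoc, ← mul_pow]; congr 2; ring
          _ ≤ _ := by gcongr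
    _ ≤ (200 * τ) ^ n * ∑ m ∈ Finset.range N, ‖taylor R x₀ m‖ * (1 / 200 : ℝ) ^ m := by
        rw [← Finset.mul_sum]
        refine mul_le_mul_of_nonneg_left (Finset.sum_le_sum_of_subset_of_nonneg (fun m hm => ?_)
          fun _ _ _ => by positivity) (by positivity)
        exact Finset.mem_range.2 (Finset.mem_Ico.1 hm).2
    _ ≤ _ := by
        rw [mul_comm]
        exact mul_le_mul_of_nonneg_right (sum_norm_taylor_le hR hx₀ N) (by positivity)

theorem norm_taylorPoly_le (hR : ∀ a b c, ‖R a b c‖ ≤ ‖a‖ * ‖b‖ * ‖c‖) (hx₀ : ‖x₀‖ ≤ 5)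
    (N : ℕ) {τ : ℝ} (h0 : 0 ≤ τ) (hτ : τ ≤ 1 / 200) : ‖taylorPoly R x₀ N τ‖ ≤ 10 := by
  have h := sum_norm_taylor_tail_le hR hx₀ 0 (N + 1) h0 hτ
  rw [pow_zero, mul_one, ← Finset.range_eq_Ico] at h
  refine (norm_sum_le _ _).trans (le_trans (le_of_eq ?_) h)
  refine Finset.sum_congr rfl fun m _ => ?_
  rw [norm_smul, norm_pow, Real.norm_of_nonneg h0]

theorem taylorPoly_cubic (N : ℕ) (τ : ℝ) :
    R (taylorPoly R x₀ N τ) (taylorPoly R x₀ N τ) (taylorPoly R x₀ N τ)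
      = ∑ x ∈ cube (N + 1), τ ^ (x.1 + x.2.1 + x.2.2) •
        R (taylor R x₀ x.1) (taylor R x₀ x.2.1) (taylor R x₀ x.2.2) := by
  have h : ∀ a b, R a b (taylorPoly R x₀ N τ)
      = ∑ r ∈ Finset.range (N + 1), τ ^ r • R a b (taylor R x₀ r) := fun a b => by
    simp only [taylorPoly, map_sum, map_smul]
  have h' : ∀ a c, R a (taylorPoly R x₀ N τ) c
      = ∑ r ∈ Finset.range (N + 1), τ ^ r • R a (taylor R x₀ r) c := fun a b => by
    simp only [taylorPoly, map_sum, map_smul, LinearMap.sum_apply, LinearMap.smul_apply]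
  have h'' : ∀ b c, R (taylorPoly R x₀ N τ) b c
      = ∑ r ∈ Finset.range (N + 1), τ ^ r • R (taylor R x₀ r) b c := fun a b => by
    simp only [taylorPoly, map_sum, map_smul, LinearMap.sum_apply, LinearMap.smul_apply]
  rw [h'', cube, Finset.sum_product]
  refine Finset.sum_congr rfl fun p _ => ?_
  rw [h', Finset.sum_product, Finset.smul_sum]
  refine Finset.sum_congr rfl fun q _ => ?_
  rw [h, Finset.smul_sum, Finset.smul_sum]
  refine Finset.sum_congr rfl fun r _ => ?_
  rw [smul_smul, smul_smul, pow_add, pow_add]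

theorem hasDerivAt_taylorPoly (N : ℕ) (τ : ℝ) :
    HasDerivAt (taylorPoly R x₀ N)
      (∑ x ∈ (cube N).filter (fun x => x.1 + x.2.1 + x.2.2 < N), τ ^ (x.1 + x.2.1 + x.2.2) •
        R (taylor R x₀ x.1) (taylor R x₀ x.2.1) (taylor R x₀ x.2.2)) τ := by
  have h : HasDerivAt (fun τ => ∑ m ∈ Finset.range (N + 1), τ ^ m • taylor R x₀ m)
      (∑ m ∈ Finset.range (N + 1), ((m : ℝ) * τ ^ (m - 1)) • taylor R x₀ m) τ :=
    HasDerivAt.fun_sum fun m _ => (hasDerivAt_pow m τ).smul_const _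
  refine h.congr_deriv ?_
  rw [Finset.sum_range_succ', ← sum_triples]
  simp only [Nat.cast_zero, zero_mul, zero_smul, add_zero]
  refine Finset.sum_congr rfl fun m _ => ?_
  rw [taylor_succ, smul_smul, Finset.smul_sum]
  refine Finset.sum_congr rfl fun x hx => ?_
  rw [mem_triples.1 hx, Nat.add_sub_cancel]
  congr 1
  push_cast
  have : (m : ℝ) + 1 ≠ 0 := by positivity
  field_simp

/-- The derivative of the polynomial contains the triples of orders with sum below `N`, the cubic
term all triples of orders up to `N`. The difference involves only sums at least `N`, each carrying
a factor `(200τ)^N`. Taking `τ` at most half of the radius `1/200` makes this factor at most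
`2^{-N}`. -/
theorem norm_taylorPoly_defect_le (hR : ∀ a b c, ‖R a b c‖ ≤ ‖a‖ * ‖b‖ * ‖c‖) (hx₀ : ‖x₀‖ ≤ 5)
    (N : ℕ) {τ : ℝ} (h0 : 0 ≤ τ) (hτ : τ ≤ 1 / 400) :
    ‖(∑ x ∈ (cube N).filter (fun x => x.1 + x.2.1 + x.2.2 < N), τ ^ (x.1 + x.2.1 + x.2.2) •
        R (taylor R x₀ x.1) (taylor R x₀ x.2.1) (taylor R x₀ x.2.2)) -
      R (taylorPoly R x₀ N τ) (taylorPoly R x₀ N τ) (taylorPoly R x₀ N τ)‖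
      ≤ 1000 * (1 / 2 : ℝ) ^ N := by
  -- A sum below `N` already forces every index below `N`, so the size of the cube is immaterial.
  have hf : (cube N).filter (fun x => x.1 + x.2.1 + x.2.2 < N)
      = (cube (N + 1)).filter (fun x => x.1 + x.2.1 + x.2.2 < N) := by
    ext x
    simp only [cube, Finset.mem_filter, Finset.mem_product, Finset.mem_range]
    omega
  rw [taylorPoly_cubic, hf, ← Finset.sum_filter_add_sum_filter_not (cube (N + 1))
    (fun x => x.1 + x.2.1 + x.2.2 < N), sub_add_cancel_left, norm_neg]
  set c : ℕ → ℝ := fun m => ‖taylor R x₀ m‖ * (1 / 200 : ℝ) ^ m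
  have hc : ∀ m, 0 ≤ c m := fun m => by positivity
  calc _ ≤ ∑ x ∈ (cube (N + 1)).filter (fun x => ¬ x.1 + x.2.1 + x.2.2 < N),
        (1 / 2 : ℝ) ^ N * (c x.1 * c x.2.1 * c x.2.2) := by
        refine (norm_sum_le _ _).trans (Finset.sum_le_sum fun x hx => ?_)
        have hN : N ≤ x.1 + x.2.1 + x.2.2 := not_lt.1 (Finset.mem_filter.1 hx).2
        rw [norm_smul, norm_pow, Real.norm_of_nonneg h0]
        have h1 : (200 * τ) ^ (x.1 + x.2.1 + x.2.2) ≤ (1 / 2 : ℝ) ^ N :=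
          (pow_le_pow_left₀ (by positivity) (by linarith : 200 * τ ≤ 1 / 2) _).trans
            (pow_le_pow_of_le_one (by norm_num) (by norm_num) hN)
        have h2 : τ ^ (x.1 + x.2.1 + x.2.2)
            = (200 * τ) ^ (x.1 + x.2.1 + x.2.2) * ((1 / 200 : ℝ) ^ x.1 * (1 / 200 : ℝ) ^ x.2.1 *
              (1 / 200 : ℝ) ^ x.2.2) := by
          rw [← pow_add, ← pow_add, ← mul_pow]; congr 1; ring
        calc _ ≤ τ ^ (x.1 + x.2.1 + x.2.2) *
              (‖taylor R x₀ x.1‖ * ‖taylor R x₀ x.2.1‖ * ‖taylor R x₀ x.2.2‖) := by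
              gcongr; exact hR _ _ _
          _ = (200 * τ) ^ (x.1 + x.2.1 + x.2.2) * (c x.1 * c x.2.1 * c x.2.2) := by
              rw [h2]; simp only [c]; ring
          _ ≤ _ := mul_le_mul_of_nonneg_right h1
              (mul_nonneg (mul_nonneg (hc _) (hc _)) (hc _))
    _ ≤ ∑ x ∈ cube (N + 1), (1 / 2 : ℝ) ^ N * (c x.1 * c x.2.1 * c x.2.2) :=
        Finset.sum_le_sum_of_subset_of_nonneg (Finset.filter_subset _ _) fun x _ _ =>
          mul_nonneg (by positivity) (mul_nonneg (mul_nonneg (hc _) (hc _)) (hc _))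
    _ ≤ (1 / 2 : ℝ) ^ N * (10 * 10 * 10) := by
        rw [← Finset.mul_sum, sum_cube]
        have h1 : ∑ m ∈ Finset.range (N + 1), c m ≤ 10 := sum_norm_taylor_le hR hx₀ (N + 1)
        have h2 : 0 ≤ ∑ m ∈ Finset.range (N + 1), c m := Finset.sum_nonneg fun m _ => hc m
        gcongr
    _ = _ := by ring

end Series

/-! ### Averaging -/

section Averaging

variable {d : ℕ}

/-- The resonant cubic interaction as a trilinear map. -/
def resonant {lam : ℝ} (hlam : |lam| = 1) :
    Ell1 (Fin d → ℤ) →ₗ[ℝ] Ell1 (Fin d → ℤ) →ₗ[ℝ] Ell1 (Fin d → ℤ) →ₗ[ℝ] Ell1 (Fin d → ℤ) where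
  toFun a := LinearMap.mk₂ ℝ (fun b c => nl (resW lam) (norm_resW hlam) a b c)
    (fun _ _ _ => by simp [nl, cub, star_add])
    (fun _ _ _ => by simp [nl, cub, star_smul])
    (fun _ _ _ => by simp [nl, cub])
    (fun _ _ _ => by simp [nl, cub])
  map_add' _ _ := LinearMap.ext₂ fun _ _ => by simp [nl, cub]
  map_smul' _ _ := LinearMap.ext₂ fun _ _ => by simp [nl, cub]

theorem resonant_apply {lam : ℝ} (hlam : |lam| = 1) (a b c : Ell1 (Fin d → ℤ)) :
    resonant hlam a b c = nl (resW lam) (norm_resW hlam) a b c := rfl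

theorem norm_resonant_le {lam : ℝ} (hlam : |lam| = 1) (a b c : Ell1 (Fin d → ℤ)) :
    ‖resonant hlam a b c‖ ≤ ‖a‖ * ‖b‖ * ‖c‖ := by
  have := norm_nl_le (resW lam) (norm_resW hlam) a b c
  rwa [one_mul] at this

theorem norm_smul_primW {lam ε : ℝ} (hlam : |lam| = 1) (h0 : 0 ≤ ε) (t : ℝ) (x : Triple d) :
    ‖(ε : ℂ) * primW lam t x‖ ≤ ε := by
  rw [norm_mul, Complex.norm_real, Real.norm_of_nonneg h0]
  exact mul_le_of_le_one_right h0 (norm_primW hlam t x)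

/-- The operator does not depend on the bound recorded in its proof argument. The product rule wants
one bound, here 1, for a weight and its derivative; the sharper bound `ε` for the weight alone is
recovered afterwards. -/
theorem Ell1.norm_mulW_le' {κ : Type*} {C C' : ℝ} (w : κ → ℂ) (hw : ∀ i, ‖w i‖ ≤ C)
    (hw' : ∀ i, ‖w i‖ ≤ C') (f : Ell1 κ) : ‖Ell1.mulW w hw f‖ ≤ C' * ‖f‖ :=
  Ell1.norm_mulW_le w hw' f

/-- A profile, corrected by the nonresonant oscillations, nearly solves the resonant equation. -/
theorem exists_corrected_profile {lam ε : ℝ} (hlam : |lam| = 1) (hε : 0 < ε) (hε1 : ε ≤ 1)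
    {T : ℝ} {b : ℝ → Ell1 (Fin d → ℤ)} (hb : ∀ τ ∈ Icc 0 T, ‖b τ‖ ≤ 10 ∧
      HasDerivWithinAt b (nl (fullW lam (τ / ε)) (norm_fullW hlam _) (b τ) (b τ) (b τ))
        (Icc 0 T) τ) :
    ∃ B B' : ℝ → Ell1 (Fin d → ℤ), ∀ τ ∈ Icc 0 T, ‖b τ - B τ‖ ≤ 1000 * ε ∧
      HasDerivWithinAt B (B' τ) (Icc 0 T) τ ∧
      ‖B' τ - resonant hlam (b τ) (b τ) (b τ)‖ ≤ 300000 * ε := by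
  have hw : ∀ (τ : ℝ) (x : Triple d), ‖(ε : ℂ) * primW lam (τ / ε) x‖ ≤ 1 := fun τ x =>
    (norm_smul_primW hlam hε.le _ x).trans hε1
  -- The prefactor `ε` cancels the `1/ε` from the fast time: a weight of size `ε` has the whole
  -- nonresonant weight, of size 1, as its derivative.
  have hd : ∀ (τ : ℝ) (x : Triple d), HasDerivAt (fun τ => (ε : ℂ) * primW lam (τ / ε) x)
      (fullW lam (τ / ε) x - resW lam x) τ := fun τ x => by
    have h1 : HasDerivAt (fun τ : ℝ => τ / ε) (1 / ε) τ := (hasDerivAt_id' τ).div_const ε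
    refine (((hasDerivAt_primW lam (τ / ε) x).scomp τ h1).const_mul (ε : ℂ)).congr_deriv ?_
    have : (ε : ℂ) ≠ 0 := by exact_mod_cast hε.ne'
    rw [Complex.real_smul]
    push_cast
    field_simp
  set N : ℝ → Ell1 (Fin d → ℤ) := fun τ => nl (fullW lam (τ / ε)) (norm_fullW hlam _)
    (b τ) (b τ) (b τ) with hN
  set D : ℝ → Ell1 (Triple d) := fun τ =>
    cub (N τ) (b τ) (b τ) + cub (b τ) (N τ) (b τ) + cub (b τ) (b τ) (N τ) with hD
  -- The normal form `B = b - ε Φ(τ/ε)(b, b, b)`. Differentiating the weight `εΦ` cancels the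
  -- nonresonant part of `b'`; differentiating the cubic expression leaves the term in `D`, which
  -- still carries the factor `ε`.
  refine ⟨fun τ => b τ - Ell1.push outFreq (Ell1.mulW (fun x => (ε : ℂ) * primW lam (τ / ε) x)
      (hw τ) (cub (b τ) (b τ) (b τ))),
    fun τ => resonant hlam (b τ) (b τ) (b τ) - Ell1.push outFreq (Ell1.mulW
      (fun x => (ε : ℂ) * primW lam (τ / ε) x) (hw τ) (D τ)), fun τ hτ => ?_⟩
  obtain ⟨hbn, hbd⟩ := hb τ hτ
  refine ⟨?_, ?_, ?_⟩
  · rw [sub_sub_cancel]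
    refine (Ell1.norm_push_le _ _).trans ((Ell1.norm_mulW_le' _ _
      (norm_smul_primW hlam hε.le _) _).trans ?_)
    rw [norm_cub, mul_comm]
    have : ‖b τ‖ * ‖b τ‖ * ‖b τ‖ ≤ 10 * 10 * 10 := by gcongr
    nlinarith
  · have h1 := Ell1.hasDerivWithinAt_mulW hw (fun τ => norm_fullW_sub_resW hlam (τ / ε)) hd
      (hasDerivWithinAt_cub hbd)
    have h2 := (Ell1.push outFreq).hasFDerivAt.comp_hasDerivWithinAt τ h1
    refine (hbd.sub h2).congr_deriv ?_
    have h3 : Ell1.mulW (fun x => fullW lam (τ / ε) x - resW lam x)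
        (norm_fullW_sub_resW hlam (τ / ε)) (cub (b τ) (b τ) (b τ))
        = Ell1.mulW (fullW lam (τ / ε)) (norm_fullW hlam _) (cub (b τ) (b τ) (b τ))
          - Ell1.mulW (resW lam) (norm_resW hlam) (cub (b τ) (b τ) (b τ)) :=
      Ell1.ext' fun x => by simp [sub_mul]
    rw [h3, map_add, map_sub]
    simp only [resonant_apply, nl, hN, hD]
    abel
  · rw [sub_sub_cancel_left, norm_neg]
    refine (Ell1.norm_push_le _ _).trans ((Ell1.norm_mulW_le' _ _
      (norm_smul_primW hlam hε.le _) _).trans ?_)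
    have hNn : ‖N τ‖ ≤ 1000 := by
      refine (norm_nl_le _ _ _ _ _).trans ?_
      calc 1 * (‖b τ‖ * ‖b τ‖ * ‖b τ‖) ≤ 1 * (10 * 10 * 10) := by gcongr
        _ = _ := by norm_num
    -- Three terms, each with one factor of norm at most 1000 and two of norm at most 10.
    have : ‖D τ‖ ≤ 300000 := by
      refine norm_add₃_le.trans ?_
      simp only [norm_cub]
      calc ‖N τ‖ * ‖b τ‖ * ‖b τ‖ + ‖b τ‖ * ‖N τ‖ * ‖b τ‖ + ‖b τ‖ * ‖b τ‖ * ‖N τ‖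
          ≤ 1000 * 10 * 10 + 10 * 1000 * 10 + 10 * 10 * 1000 := by gcongr
        _ = _ := by norm_num
    nlinarith

theorem gronwallBound_le {δ K ε x X : ℝ} (hδ : 0 ≤ δ) (hε : 0 ≤ ε) (hK : 1 ≤ K)
    (hx : x ≤ X) : gronwallBound δ K ε x ≤ (δ + ε) * Real.exp (K * X) := by
  rw [gronwallBound_of_K_ne_0 (by linarith)]
  have h1 : Real.exp (K * x) ≤ Real.exp (K * X) := by gcongr
  have h2 : ε / K ≤ ε := div_le_self hε hK
  have h3 : ε / K * (Real.exp (K * x) - 1) ≤ ε / K * Real.exp (K * X) := by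
    gcongr; linarith
  have h4 : ε / K * Real.exp (K * X) ≤ ε * Real.exp (K * X) := by gcongr
  have h5 : δ * Real.exp (K * x) ≤ δ * Real.exp (K * X) := by gcongr
  linarith

theorem resonant_lipschitz {lam : ℝ} (hlam : |lam| = 1) {a b : Ell1 (Fin d → ℤ)} {ρ : ℝ}
    (ha : ‖a‖ ≤ ρ) (hb : ‖b‖ ≤ ρ) :
    ‖resonant hlam a a a - resonant hlam b b b‖ ≤ 3 * ρ ^ 2 * ‖a - b‖ :=
  norm_nl_sub_nl_le _ _ ha hb

/-- The profile is close to the Taylor polynomials of the resonant solution. -/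
theorem exists_norm_profile_sub_taylorPoly_le :
    ∃ C : ℝ, 0 < C ∧ ∀ {lam ε : ℝ} (hlam : |lam| = 1), 0 < ε → ε ≤ 1 →
      ∀ b : ℝ → Ell1 (Fin d → ℤ), ‖b 0‖ ≤ 5 →
      (∀ τ ∈ Icc (0 : ℝ) (1 / 400), ‖b τ‖ ≤ 10 ∧
        HasDerivWithinAt b (nl (fullW lam (τ / ε)) (norm_fullW hlam _) (b τ) (b τ) (b τ))
          (Icc 0 (1 / 400)) τ) →
      ∀ N : ℕ, ∀ τ ∈ Icc (0 : ℝ) (1 / 400),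
        ‖b τ - taylorPoly (resonant hlam) (b 0) N τ‖ ≤ C * (ε + (1 / 2) ^ N) := by
  -- Lipschitz constant on the ball of radius `1010 = 10 + 1000`, which contains the corrected
  -- profile because `ε ≤ 1`.
  set K : ℝ := 3 * 1010 ^ 2 with hKdef
  set L : ℝ := Real.exp (K * (1 / 400)) with hL
  have hL1 : 1 ≤ L := Real.one_le_exp (by positivity)
  refine ⟨(K * 1000 + 400000) * L, by positivity, ?_⟩
  intro lam ε hlam hε hε1 b hb0 hb N τ hτ
  obtain ⟨B, B', hB⟩ := exists_corrected_profile hlam hε hε1 hb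
  have hBn : ∀ τ ∈ Icc (0 : ℝ) (1 / 400), ‖B τ‖ ≤ 1010 := fun τ hτ => by
    have h1 := (hB τ hτ).1
    have h2 := (hb τ hτ).1
    have h3 := norm_le_norm_add_norm_sub (b τ) (B τ)
    linarith
  have hzero : (0 : ℝ) ∈ Icc (0 : ℝ) (1 / 400) := ⟨le_rfl, by norm_num⟩
  -- Both `B` and the Taylor polynomial are approximate trajectories of the resonant equation: their
  -- defects are `O(ε)` and `O(2^{-N})`, and their initial distance is `O(ε)`. No exact resonant
  -- solution is needed.
  have hg := dist_le_of_approx_trajectories_ODE_of_mem (K := ⟨K, by positivity⟩)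
    (v := fun _ x => resonant hlam x x x) (s := fun _ => {x | ‖x‖ ≤ 1010})
    (a := 0) (b := 1 / 400)
    (f := B) (f' := B') (εf := K * (1000 * ε) + 300000 * ε)
    (g := taylorPoly (resonant hlam) (b 0) N) (εg := 1000 * (1 / 2) ^ N) (δ := 1000 * ε)
    (fun t _ => LipschitzOnWith.of_dist_le_mul fun x hx y hy => by
      rw [dist_eq_norm, dist_eq_norm]; exact resonant_lipschitz hlam hx hy)
    (fun t ht => (hB t ht).2.1.continuousWithinAt)
    (fun t ht => hasDerivWithinAt_Ici_of_Icc (hB t (Ico_subset_Icc_self ht)).2.1 ht)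
    (fun t ht => by
      have ht' := Ico_subset_Icc_self ht
      have h1 := resonant_lipschitz hlam (((hb t ht').1).trans (by norm_num : (10 : ℝ) ≤ 1010))
        (hBn t ht')
      rw [dist_eq_norm, ← sub_add_sub_cancel (B' t) (resonant hlam (b t) (b t) (b t))]
      refine (norm_add_le _ _).trans ?_
      have h2 := (hB t ht').1
      have h3 := (hB t ht').2.2
      have h4 : K * ‖b t - B t‖ ≤ K * (1000 * ε) := by gcongr
      linarith)
    (fun t ht => hBn t (Ico_subset_Icc_self ht))
    (fun t _ => (hasDerivAt_taylorPoly N t).continuousAt.continuousWithinAt)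
    (fun t _ => (hasDerivAt_taylorPoly N t).hasDerivWithinAt)
    (fun t ht => by
      rw [dist_eq_norm]
      exact norm_taylorPoly_defect_le (norm_resonant_le hlam) hb0 N ht.1 ht.2.le)
    (fun t ht => (norm_taylorPoly_le (norm_resonant_le hlam) hb0 N ht.1
      (ht.2.le.trans (by norm_num))).trans (by norm_num))
    (by
      rw [taylorPoly_zero, dist_comm, dist_eq_norm]
      exact (hB 0 hzero).1) τ hτ
  have h1 := hg.trans (gronwallBound_le (X := 1 / 400) (by positivity) (by positivity)
    (show (1 : ℝ) ≤ K by norm_num [hKdef]) (by linarith [hτ.2]))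
  rw [dist_eq_norm] at h1
  have h2 := (hB τ hτ).1
  have h3 : ‖b τ - taylorPoly (resonant hlam) (b 0) N τ‖
      ≤ ‖b τ - B τ‖ + ‖B τ - taylorPoly (resonant hlam) (b 0) N τ‖ :=
    norm_sub_le_norm_sub_add_norm_sub _ _ _
  have h4 : 1000 * ε ≤ 1000 * ε * L := le_mul_of_one_le_right (by positivity) hL1
  have h5 : 0 ≤ (1 / 2 : ℝ) ^ N * L := by positivity
  have h6 : 0 ≤ ε * L := by positivity
  have hK0 : 0 ≤ K := by positivity
  change _ ≤ _ * L at h1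
  nlinarith [mul_nonneg hK0 h5]

end Averaging

/-! ### The five-mode datum -/

section Datum

variable {d : ℕ}

/-- The frequency `(a, b, 0, …, 0)`. -/
def planar (d : ℕ) (a b : ℤ) : Fin d → ℤ :=
  fun i => if (i : ℕ) = 0 then a else if (i : ℕ) = 1 then b else 0

theorem eq_planar (hd : 2 ≤ d) {j : Fin d → ℤ} (hj : ∀ i : Fin d, 2 ≤ (i : ℕ) → j i = 0) :
    j = planar d (j ⟨0, by omega⟩) (j ⟨1, by omega⟩) := by
  ext ⟨i, hi⟩
  unfold planar
  split_ifs with h h'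
  · simp only at h; subst h; rfl
  · simp only at h'; subst h'; rfl
  · simp only at h h'
    exact hj _ (by simp only; omega)

theorem normSq_planar (hd : 2 ≤ d) (a b : ℤ) :
    normSq (planar d a b) = a.natAbs ^ 2 + b.natAbs ^ 2 := by
  have hne : (⟨0, by omega⟩ : Fin d) ≠ ⟨1, by omega⟩ := by simp
  rw [normSq, ← Finset.sum_subset (Finset.subset_univ {(⟨0, by omega⟩ : Fin d), ⟨1, by omega⟩}),
    Finset.sum_pair hne]
  · simp [planar]
  · intro i _ hi
    simp only [Finset.mem_insert, Finset.mem_singleton, not_or, Fin.ext_iff] at hi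
    simp [planar, hi.1, hi.2]

theorem planar_add (a b a' b' : ℤ) :
    planar d a b + planar d a' b' = planar d (a + a') (b + b') := by
  ext i
  simp only [planar, Pi.add_apply]
  split_ifs <;> simp

theorem planar_zero : planar d 0 0 = 0 := by
  ext i; simp [planar]

theorem planar_injective (hd : 2 ≤ d) {a b a' b' : ℤ} (h : planar d a b = planar d a' b') :
    a = a' ∧ b = b' := by
  have h0 := congrFun h ⟨0, by omega⟩
  have h1 := congrFun h ⟨1, by omega⟩
  simpa [planar] using And.intro h0 h1

/-- The element of `ℓ¹` supported at one frequency. -/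
def delta (k : Fin d → ℤ) : Ell1 (Fin d → ℤ) := lp.single 1 k (1 : ℂ)

theorem delta_apply (k j : Fin d → ℤ) : delta k j = if j = k then 1 else 0 := by
  rw [delta, lp.single_apply, Pi.single_apply]

theorem norm_delta (k : Fin d → ℤ) : ‖delta k‖ = 1 := by
  rw [delta, lp.norm_single (by simp), norm_one]

/-- The Fourier coefficients of the five-mode datum. -/
def datum (d : ℕ) : Ell1 (Fin d → ℤ) :=
  delta (planar d 0 0) + delta (planar d 1 0) + delta (planar d (-1) 0) +
    delta (planar d 0 1) + delta (planar d 0 (-1))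

theorem norm_datum_le : ‖datum d‖ ≤ 5 := by
  unfold datum
  refine (norm_add_le _ _).trans ?_
  have := norm_add₄_le (a := delta (planar d 0 0)) (b := delta (planar d 1 0))
    (c := delta (planar d (-1) 0)) (d := delta (planar d 0 1))
  simp only [norm_delta] at *
  linarith

theorem character_planar (hd : 2 ≤ d) (a b : ℤ) (x : Torus d) :
    character (planar d a b) x
      = fourier a (x ⟨0, by omega⟩) * fourier b (x ⟨1, by omega⟩) := by
  have hne : (⟨0, by omega⟩ : Fin d) ≠ ⟨1, by omega⟩ := by simp
  rw [character, ← Finset.prod_subset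
    (Finset.subset_univ {(⟨0, by omega⟩ : Fin d), ⟨1, by omega⟩}), Finset.prod_pair hne]
  · simp [planar]
  · intro i _ hi
    simp only [Finset.mem_insert, Finset.mem_singleton, not_or, Fin.ext_iff] at hi
    simp [planar, hi.1, hi.2]

theorem fourier_add_fourier_neg (x : AddCircle (2 * Real.pi)) :
    fourier 1 x + fourier (-1) x = ((2 * Real.Angle.cos x : ℝ) : ℂ) := by
  induction x using QuotientAddGroup.induction_on with
  | H y =>
    have h : Real.Angle.cos (y : Real.Angle) = Real.cos y := Real.Angle.cos_coe y
    change fourier 1 (y : AddCircle (2 * Real.pi)) + fourier (-1) (y : AddCircle (2 * Real.pi))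
      = ((2 * Real.Angle.cos (y : Real.Angle) : ℝ) : ℂ)
    rw [h, fourier_two_pi, fourier_two_pi]
    push_cast
    rw [Complex.two_cos]
    congr 2 <;> ring

theorem synth_datum (hd : 2 ≤ d) : synth (datum d) = fiveMode hd := by
  ext x
  simp only [datum, synth_add, delta, synth_single, Pi.add_apply, character_planar hd, fiveMode,
    fourier_zero, one_mul, mul_one]
  have h0 := fourier_add_fourier_neg (x ⟨0, by omega⟩)
  have h1 := fourier_add_fourier_neg (x ⟨1, by omega⟩)
  push_cast at h0 h1 ⊢
  linear_combination h0 + h1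

theorem datum_nonneg (j : Fin d → ℤ) : ∃ β : ℝ, 0 ≤ β ∧ datum d j = β := by
  refine ⟨(if j = planar d 0 0 then 1 else 0) + (if j = planar d 1 0 then 1 else 0) +
    (if j = planar d (-1) 0 then 1 else 0) + (if j = planar d 0 1 then 1 else 0) +
    (if j = planar d 0 (-1) then 1 else 0), by positivity, ?_⟩
  have h : ∀ k : Fin d → ℤ, ((if j = k then 1 else 0 : ℝ) : ℂ) = if j = k then 1 else 0 :=
    fun k => by split_ifs <;> simp
  simp only [datum, Ell1.add_apply', delta_apply, Complex.ofReal_add, h]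

theorem datum_zero (hd : 2 ≤ d) : datum d 0 = 1 := by
  have h : ∀ a b : ℤ, (0 : Fin d → ℤ) = planar d a b ↔ a = 0 ∧ b = 0 := fun a b =>
    ⟨fun h => by
      rw [← planar_zero] at h
      have := planar_injective hd h
      exact ⟨this.1.symm, this.2.symm⟩, fun h => by rw [h.1, h.2, planar_zero]⟩
  simp [datum, delta_apply, h]

theorem datum_eq_zero (hd : 2 ≤ d) {j : Fin d → ℤ} (hj : 1 < normSq j) : datum d j = 0 := by
  have h : ∀ a b : ℤ, a.natAbs ^ 2 + b.natAbs ^ 2 ≤ 1 → j ≠ planar d a b := by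
    rintro a b hab rfl
    rw [normSq_planar hd] at hj
    omega
  simp [datum, delta_apply, h 0 0 (by simp), h 1 0 (by simp), h (-1) 0 (by simp),
    h 0 1 (by simp), h 0 (-1) (by simp)]

theorem one_le_datum (hd : 2 ≤ d) {j : Fin d → ℤ} (hj : j ∈ extremalModes hd)
    (h1 : normSq j = 1) : 1 ≤ (datum d j).re := by
  have hpl := eq_planar hd hj.1
  obtain ⟨_, p, hp⟩ := hj
  generalize j ⟨0, by omega⟩ = a at *
  generalize j ⟨1, by omega⟩ = b at *
  subst hpl
  rw [normSq_planar hd] at h1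
  have ha : a.natAbs ≤ 1 := by nlinarith
  have hb : b.natAbs ≤ 1 := by nlinarith
  have hcase : (a = 1 ∧ b = 0) ∨ (a = -1 ∧ b = 0) ∨ (a = 0 ∧ b = 1) ∨ (a = 0 ∧ b = -1) := by
    have h2 : a = 0 ∨ a = 1 ∨ a = -1 := by omega
    have h3 : b = 0 ∨ b = 1 ∨ b = -1 := by omega
    rcases h2 with rfl | rfl | rfl <;> rcases h3 with rfl | rfl | rfl <;> simp at h1 ⊢
  have hinj : ∀ a b a' b' : ℤ, planar d a b = planar d a' b' ↔ a = a' ∧ b = b' :=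
    fun a b a' b' => ⟨planar_injective hd, fun h => by rw [h.1, h.2]⟩
  rcases hcase with h | h | h | h <;> obtain ⟨rfl, rfl⟩ := h <;>
    simp [datum, delta_apply, hinj]

end Datum

/-! ### Leading Taylor coefficients of the resonant solution -/

section Leading

variable {d : ℕ} {lam : ℝ}

/-- Taylor coefficients of the resonant profile. -/
def resCoef (d : ℕ) (hlam : |lam| = 1) (m : ℕ) : Ell1 (Fin d → ℤ) :=
  taylor (resonant hlam) (datum d) m

/-- The contribution of one interaction to a Taylor coefficient. -/
def resTerm (hlam : |lam| = 1) (j : Fin d → ℤ) (y : ℕ × ℕ × ℕ) (x : Triple d) : ℂ :=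
  haveI := Classical.propDecidable (outFreq x = j)
  if outFreq x = j then resW lam x * (resCoef d hlam y.1 x.1 *
    (star (resCoef d hlam y.2.1 x.2.1) * resCoef d hlam y.2.2 x.2.2)) else 0

theorem summable_resTerm (hlam : |lam| = 1) (j : Fin d → ℤ) (y : ℕ × ℕ × ℕ) :
    Summable (resTerm hlam j y) :=
  (Ell1.summable_norm_fiber outFreq (Ell1.mulW (resW lam) (norm_resW hlam)
    (cub (resCoef d hlam y.1) (resCoef d hlam y.2.1) (resCoef d hlam y.2.2))) j).of_norm

theorem resCoef_succ (hlam : |lam| = 1) (m : ℕ) (j : Fin d → ℤ) :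
    resCoef d hlam (m + 1) j
      = ((m + 1 : ℝ)⁻¹ : ℂ) * ∑ y ∈ triples m, ∑' x, resTerm hlam j y x := by
  have h := congrArg (Ell1.eval j) (taylor_succ (R := resonant hlam) (x₀ := datum d) m)
  rw [map_smul, map_sum, Complex.real_smul] at h
  rw [Complex.ofReal_inv] at h
  exact h

theorem mul_neg_mul_pow (hlam : |lam| = 1) (m : ℕ) :
    (Complex.I * lam) ^ m * (-(Complex.I * lam)) ^ m = 1 := by
  rw [← mul_pow]
  have h1 : (lam : ℂ) ^ 2 = 1 := by
    have : lam ^ 2 = 1 := by rw [← sq_abs, hlam, one_pow]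
    exact_mod_cast this
  have : Complex.I * lam * -(Complex.I * lam) = 1 := by
    linear_combination (-(lam : ℂ) ^ 2) * Complex.I_sq + h1
  rw [this, one_pow]

/-- The properties of the Taylor coefficient of order `m`: it vanishes at the frequencies `j` with
`|j|² > m + 1`, and has a fixed phase at those with `|j|² = m + 1`. -/
def LeadingAt (d : ℕ) (hlam : |lam| = 1) (m : ℕ) : Prop :=
  (∀ j : Fin d → ℤ, m + 1 < normSq j → resCoef d hlam m j = 0) ∧
  ∀ j : Fin d → ℤ, normSq j = m + 1 →
    ∃ β : ℝ, 0 ≤ β ∧ resCoef d hlam m j = (-(Complex.I * lam)) ^ m * β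

/-- With orders `p + q + r = m`, resonance and the vanishing statement give `|j|² + |l|² = |k|² +
|m|² ≤ p + r + 2 = m + 2 - q`, where the `m` in `|m|²` is the third frequency. If `|j|² ≥ m + 2`,
all inequalities are equalities and `q = 0`, `l = 0`. -/
theorem eq_of_resTerm_ne_zero (hlam : |lam| = 1) {m : ℕ} (ih : ∀ p ≤ m, LeadingAt d hlam p)
    {j : Fin d → ℤ} (hj : m + 2 ≤ normSq j) {y : ℕ × ℕ × ℕ} (hy : y ∈ triples m) {x : Triple d}
    (h : resTerm hlam j y x ≠ 0) :
    normSq j = m + 2 ∧ y.2.1 = 0 ∧ x.2.1 = 0 ∧ normSq x.1 = y.1 + 1 ∧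
      normSq x.2.2 = y.2.2 + 1 ∧ modulus x = 0 ∧ outFreq x = j := by
  have hm := mem_triples.1 hy
  unfold resTerm at h
  split_ifs at h with hout
  · have hmod : modulus x = 0 := by
      by_contra hne
      simp [resW, hne] at h
    have h1 : normSq x.1 ≤ y.1 + 1 := by
      by_contra! hlt
      simp [(ih y.1 (by omega)).1 _ hlt] at h
    have h2 : normSq x.2.1 ≤ y.2.1 + 1 := by
      by_contra! hlt
      simp [(ih y.2.1 (by omega)).1 _ hlt] at h
    have h3 : normSq x.2.2 ≤ y.2.2 + 1 := by
      by_contra! hlt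
      simp [(ih y.2.2 (by omega)).1 _ hlt] at h
    have h4 := hmod
    rw [modulus, hout] at h4
    have h5 : normSq x.2.1 = 0 := by omega
    refine ⟨by omega, by omega, ?_, by omega, by omega, hmod, hout⟩
    ext i
    have := (Finset.sum_eq_zero_iff.1 h5) i (Finset.mem_univ i)
    simpa using this
  · exact absurd rfl h

/-- The conjugated factor is the datum at frequency zero, equal to 1, so conjugation cannot spoil
the phase: the factors `(-iλ)^p` and `(-iλ)^r` combine with the weight `-iλ` to `(-iλ)^{m+1}`. -/
theorem resTerm_eq (hd : 2 ≤ d) (hlam : |lam| = 1) {m : ℕ} (ih : ∀ p ≤ m, LeadingAt d hlam p)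
    {j : Fin d → ℤ} (hj : m + 2 ≤ normSq j) {y : ℕ × ℕ × ℕ} (hy : y ∈ triples m) (x : Triple d) :
    ∃ β : ℝ, 0 ≤ β ∧ resTerm hlam j y x = (-(Complex.I * lam)) ^ (m + 1) * β := by
  by_cases h : resTerm hlam j y x = 0
  · exact ⟨0, le_rfl, by simp [h]⟩
  obtain ⟨-, hq, hl, hk, hr, hmod, hout⟩ := eq_of_resTerm_ne_zero hlam ih hj hy h
  have hm := mem_triples.1 hy
  obtain ⟨β, hβ, e1⟩ := (ih y.1 (by omega)).2 _ hk
  obtain ⟨β', hβ', e2⟩ := (ih y.2.2 (by omega)).2 _ hr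
  refine ⟨β * β', mul_nonneg hβ hβ', ?_⟩
  have e3 : resCoef d hlam y.2.1 x.2.1 = 1 := by
    rw [hq, hl, resCoef, taylor_zero, datum_zero hd]
  rw [resTerm, if_pos hout, resW, if_pos hmod, e1, e2, e3, star_one,
    show m + 1 = y.1 + y.2.2 + 1 by omega]
  push_cast
  ring

theorem leadingAt (hd : 2 ≤ d) (hlam : |lam| = 1) (m : ℕ) : LeadingAt d hlam m := by
  induction m using Nat.strong_induction_on with
  | _ m ih =>
    cases m with
    | zero =>
      refine ⟨fun j hj => ?_, fun j _ => ?_⟩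
      · rw [resCoef, taylor_zero, datum_eq_zero hd (by omega)]
      · obtain ⟨β, hβ, h⟩ := datum_nonneg j
        exact ⟨β, hβ, by rw [resCoef, taylor_zero, h, pow_zero, one_mul]⟩
    | succ m =>
      have ih' : ∀ p ≤ m, LeadingAt d hlam p := fun p hp => ih p (by omega)
      refine ⟨fun j hj => ?_, fun j hj => ?_⟩
      · rw [resCoef_succ, Finset.sum_eq_zero, mul_zero]
        intro y hy
        rw [tsum_congr fun x => ?_, tsum_zero]
        by_contra h
        have := (eq_of_resTerm_ne_zero hlam ih' (by omega) hy h).1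
        omega
      · choose! β hβ e using fun y (hy : y ∈ triples m) (x : Triple d) =>
          resTerm_eq hd hlam ih' (by omega : m + 2 ≤ normSq j) hy x
        refine ⟨(m + 1 : ℝ)⁻¹ * ∑ y ∈ triples m, ∑' x, β y x, ?_, ?_⟩
        · exact mul_nonneg (by positivity)
            (Finset.sum_nonneg fun y hy => tsum_nonneg fun x => hβ y hy x)
        · rw [resCoef_succ]
          push_cast
          rw [mul_left_comm]
          congr 1
          rw [Finset.mul_sum]
          refine Finset.sum_congr rfl fun y hy => ?_
          rw [← tsum_mul_left]
          exact tsum_congr fun x => e y hy x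

/-- The modulus of the leading Taylor coefficient at a frequency with `|j|² = m + 1`. -/
def leadCoef (d : ℕ) (hlam : |lam| = 1) (m : ℕ) (j : Fin d → ℤ) : ℝ :=
  ((Complex.I * lam) ^ m * resCoef d hlam m j).re

theorem leadCoef_eq (hlam : |lam| = 1) {m : ℕ} {j : Fin d → ℤ} {β : ℝ}
    (h : resCoef d hlam m j = (-(Complex.I * lam)) ^ m * β) : leadCoef d hlam m j = β := by
  rw [leadCoef, h, ← mul_assoc, mul_neg_mul_pow hlam, one_mul, Complex.ofReal_re]

theorem leadCoef_le_norm (hlam : |lam| = 1) (m : ℕ) (j : Fin d → ℤ) :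
    leadCoef d hlam m j ≤ ‖resCoef d hlam m j‖ := by
  refine (Complex.re_le_norm _).trans ?_
  simp [hlam]

/-- All contributions share one phase and have nonnegative amplitudes, so any subset of them gives a
lower bound. The interactions `(k, 0, k')` and `(k', 0, k)` at orders `(p, 0, p)` are kept; they are
resonant because `|k + k'|² = |k|² + |k'|²`. The factor `2p + 1` comes from the integration in time.
-/
theorem two_mul_leadCoef_mul_le (hd : 2 ≤ d) (hlam : |lam| = 1) {p : ℕ} {k k' : Fin d → ℤ}
    (hk : normSq k = p + 1) (hk' : normSq k' = p + 1) (hne : k ≠ k')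
    (hj : normSq (k + k') = 2 * p + 2) :
    2 * (leadCoef d hlam p k * leadCoef d hlam p k')
      ≤ (2 * p + 1) * leadCoef d hlam (2 * p + 1) (k + k') := by
  have ih : ∀ q ≤ 2 * p, LeadingAt d hlam q := fun q _ => leadingAt hd hlam q
  choose! β hβ e using fun y (hy : y ∈ triples (2 * p)) (x : Triple d) =>
    resTerm_eq hd hlam ih (j := k + k') hj.ge hy x
  have hlead : leadCoef d hlam (2 * p + 1) (k + k')
      = (2 * p + 1 : ℝ)⁻¹ * ∑ y ∈ triples (2 * p), ∑' x, β y x := by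
    refine leadCoef_eq hlam ?_
    rw [resCoef_succ]
    push_cast
    rw [mul_left_comm]
    congr 1
    rw [Finset.mul_sum]
    refine Finset.sum_congr rfl fun y hy => ?_
    rw [← tsum_mul_left]
    exact tsum_congr fun x => e y hy x
  have hterm : ∀ {k k' : Fin d → ℤ}, normSq k = p + 1 → normSq k' = p + 1 →
      normSq (k + k') = 2 * p + 2 →
      resTerm hlam (k + k') (p, 0, p) (k, 0, k') = (-(Complex.I * lam)) ^ (2 * p + 1) *
        ((leadCoef d hlam p k * leadCoef d hlam p k' : ℝ) : ℂ) := by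
    intro k k' hk hk' hj
    have hmod : modulus ((k, 0, k') : Triple d) = 0 := by
      simp only [modulus, outFreq, sub_zero, hk, hk', hj]
      have : normSq (0 : Fin d → ℤ) = 0 := by simp [normSq]
      rw [this]; push_cast; ring
    obtain ⟨b, -, e1⟩ := (leadingAt hd hlam p).2 k hk
    obtain ⟨b', -, e2⟩ := (leadingAt hd hlam p).2 k' hk'
    have hout : outFreq ((k, 0, k') : Triple d) = k + k' := by simp [outFreq]
    have e3 : resCoef d hlam 0 (0 : Fin d → ℤ) = 1 := by
      rw [resCoef, taylor_zero, datum_zero hd]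
    rw [resTerm, if_pos hout, resW, if_pos hmod, leadCoef_eq hlam e1, leadCoef_eq hlam e2]
    simp only
    rw [e1, e2, e3, star_one]
    push_cast
    ring
  have hy : ((p, 0, p) : ℕ × ℕ × ℕ) ∈ triples (2 * p) := by
    rw [mem_triples]; simp only; omega
  have hβeq : ∀ {x : Triple d} {r : ℝ}, resTerm hlam (k + k') (p, 0, p) x
      = (-(Complex.I * lam)) ^ (2 * p + 1) * (r : ℂ) → β (p, 0, p) x = r := by
    intro x r hx
    have h1 := (e _ hy x).symm.trans hx
    have h2 := mul_neg_mul_pow hlam (2 * p + 1)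
    have h3 : ((β (p, 0, p) x : ℝ) : ℂ) = (r : ℂ) :=
      mul_left_cancel₀ (right_ne_zero_of_mul_eq_one h2) h1
    exact_mod_cast h3
  have h1 := hβeq (hterm hk hk' hj)
  have h2 : β (p, 0, p) (k', 0, k) = leadCoef d hlam p k * leadCoef d hlam p k' := by
    have := hterm hk' hk (by rw [add_comm]; exact hj)
    rw [add_comm k' k] at this
    rw [hβeq this, mul_comm]
  have hsum : Summable (β (p, 0, p)) := by
    have h3 := ((summable_resTerm hlam (k + k') (p, 0, p)).mul_left
      ((Complex.I * lam) ^ (2 * p + 1)))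
    have h4 : ∀ x, (Complex.I * lam) ^ (2 * p + 1) * resTerm hlam (k + k') (p, 0, p) x
        = ((β (p, 0, p) x : ℝ) : ℂ) := fun x => by
      rw [e _ hy x, ← mul_assoc, mul_neg_mul_pow hlam, one_mul]
    simp only [h4] at h3
    exact Complex.summable_ofReal.1 h3
  -- The two ordered triples are distinct, which gives the factor 2 needed to carry the induction
  -- through.
  have hne' : ((k, 0, k') : Triple d) ≠ (k', 0, k) := fun h => hne (congrArg Prod.fst h)
  have h5 : leadCoef d hlam p k * leadCoef d hlam p k' + leadCoef d hlam p k * leadCoef d hlam p k'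
      ≤ ∑' x, β (p, 0, p) x := by
    have := hsum.sum_le_tsum {((k, 0, k') : Triple d), (k', 0, k)} (fun x _ => hβ _ hy x)
    rwa [Finset.sum_pair hne', h1, h2] at this
  have h6 : ∑' x, β (p, 0, p) x ≤ ∑ y ∈ triples (2 * p), ∑' x, β y x :=
    Finset.single_le_sum (f := fun y => ∑' x, β y x)
      (fun y hy => tsum_nonneg fun x => hβ y hy x) hy
  rw [hlead, mul_inv_cancel_left₀ (by positivity)]
  linarith

end Leading

/-! ### Extremal modes -/

section Extremal

variable {d : ℕ}

theorem planar_mem_extremalModes (hd : 2 ≤ d) {a b : ℤ} :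
    planar d a b ∈ extremalModes hd ↔ ∃ p : ℕ,
      (a = 0 ∧ |b| = 2 ^ p) ∨ (|a| = 2 ^ p ∧ b = 0) ∨ (|a| = 2 ^ p ∧ |b| = 2 ^ p) := by
  constructor
  · rintro ⟨-, p, hp⟩
    exact ⟨p, by simpa [planar] using hp⟩
  · rintro ⟨p, hp⟩
    refine ⟨fun i hi => ?_, p, by simpa [planar] using hp⟩
    rw [planar, if_neg (by omega), if_neg (by omega)]

theorem natAbs_eq_of_abs_eq {a : ℤ} {p : ℕ} (h : |a| = 2 ^ p) : a.natAbs = 2 ^ p := by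
  zify; exact h

theorem normSq_extremal (hd : 2 ≤ d) {j : Fin d → ℤ} (hj : j ∈ extremalModes hd) :
    ∃ q, normSq j = 2 ^ q := by
  have hpl := eq_planar hd hj.1
  rw [hpl] at hj ⊢
  obtain ⟨p, h⟩ := (planar_mem_extremalModes hd).1 hj
  rw [normSq_planar hd]
  rcases h with ⟨h1, h2⟩ | ⟨h1, h2⟩ | ⟨h1, h2⟩
  · exact ⟨2 * p, by rw [h1, natAbs_eq_of_abs_eq h2]; simp [pow_mul']⟩
  · exact ⟨2 * p, by rw [h2, natAbs_eq_of_abs_eq h1]; simp [pow_mul']⟩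
  · exact ⟨2 * p + 1, by rw [natAbs_eq_of_abs_eq h1, natAbs_eq_of_abs_eq h2]; ring⟩

/-- An extremal mode is the sum of two orthogonal extremal modes of equal length. -/
theorem exists_extremal_add (hd : 2 ≤ d) {j : Fin d → ℤ} (hj : j ∈ extremalModes hd) {q : ℕ}
    (hq : normSq j = 2 ^ (q + 1)) :
    ∃ k ∈ extremalModes hd, ∃ k' ∈ extremalModes hd,
      normSq k = 2 ^ q ∧ normSq k' = 2 ^ q ∧ k ≠ k' ∧ k + k' = j := by
  have hpl := eq_planar hd hj.1
  rw [hpl] at hj hq ⊢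
  generalize j ⟨0, by omega⟩ = a at *
  generalize j ⟨1, by omega⟩ = b at *
  obtain ⟨p, h⟩ := (planar_mem_extremalModes hd).1 hj
  rw [normSq_planar hd] at hq
  have hhalf : ∀ c : ℤ, |c| = 2 ^ p → c.natAbs ^ 2 = 2 ^ (q + 1) →
      ∃ e : ℤ, ∃ r : ℕ, c = e + e ∧ |e| = 2 ^ r ∧ e.natAbs ^ 2 + e.natAbs ^ 2 = 2 ^ q ∧ e ≠ 0 := by
    intro c hc hcq
    have hpq : 2 ^ (2 * p) = 2 ^ (q + 1) := by
      rw [← hcq, natAbs_eq_of_abs_eq hc, pow_mul']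
    have hpq' := Nat.pow_right_injective le_rfl hpq
    -- Here `2p = q + 1 ≥ 1`, so `p` is positive and `c` is even. An axis mode splits into two
    -- diagonal modes of half its size; a diagonal mode splits into its two coordinate components.
    obtain ⟨r, rfl⟩ : ∃ r, p = r + 1 := ⟨p - 1, by omega⟩
    have hq' : q = 2 * r + 1 := by omega
    have : ∀ e : ℤ, |e| = 2 ^ r → e.natAbs ^ 2 + e.natAbs ^ 2 = 2 ^ q ∧ e ≠ 0 := fun e he =>
      ⟨by rw [natAbs_eq_of_abs_eq he, hq']; ring, by
        rintro rfl
        have : (0 : ℤ) < 2 ^ r := by positivity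
        rw [abs_zero] at he
        exact this.ne he⟩
    rcases (abs_eq (by positivity)).1 hc with rfl | rfl
    · exact ⟨2 ^ r, r, by ring, by simp, this _ (by simp)⟩
    · exact ⟨-2 ^ r, r, by ring, by simp, this _ (by simp)⟩
  rcases h with ⟨rfl, h2⟩ | ⟨h1, rfl⟩ | ⟨h1, h2⟩
  · obtain ⟨e, r, rfl, he, hn, h0⟩ := hhalf b h2 (by simpa using hq)
    refine ⟨planar d e e, (planar_mem_extremalModes hd).2 ⟨r, Or.inr (Or.inr ⟨he, he⟩)⟩,
      planar d (-e) e, (planar_mem_extremalModes hd).2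
        ⟨r, Or.inr (Or.inr ⟨by rwa [abs_neg], he⟩)⟩, ?_, ?_, fun h => ?_, ?_⟩
    · rw [normSq_planar hd, hn]
    · rw [normSq_planar hd, Int.natAbs_neg, hn]
    · have := (planar_injective hd h).1
      omega
    · rw [planar_add, add_neg_cancel]
  · obtain ⟨e, r, rfl, he, hn, h0⟩ := hhalf a h1 (by simpa using hq)
    refine ⟨planar d e e, (planar_mem_extremalModes hd).2 ⟨r, Or.inr (Or.inr ⟨he, he⟩)⟩,
      planar d e (-e), (planar_mem_extremalModes hd).2
        ⟨r, Or.inr (Or.inr ⟨he, by rwa [abs_neg]⟩)⟩, ?_, ?_, fun h => ?_, ?_⟩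
    · rw [normSq_planar hd, hn]
    · rw [normSq_planar hd, Int.natAbs_neg, hn]
    · have := (planar_injective hd h).2
      omega
    · rw [planar_add, add_neg_cancel]
  · have ha := natAbs_eq_of_abs_eq h1
    have hb := natAbs_eq_of_abs_eq h2
    rw [ha, hb] at hq
    have hpq : (2 ^ p) ^ 2 = 2 ^ q := by rw [pow_succ 2 q] at hq; omega
    refine ⟨planar d a 0, (planar_mem_extremalModes hd).2 ⟨p, Or.inr (Or.inl ⟨h1, rfl⟩)⟩,
      planar d 0 b, (planar_mem_extremalModes hd).2 ⟨p, Or.inl ⟨rfl, h2⟩⟩, ?_, ?_, fun h => ?_, ?_⟩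
    · rw [normSq_planar hd, ha, ← hpq]; simp
    · rw [normSq_planar hd, hb, ← hpq]; simp
    · have := (planar_injective hd h).1
      have : 0 < 2 ^ p := by positivity
      omega
    · rw [planar_add, add_zero, zero_add]

/-- Induction on the splitting of an extremal mode. The normalisation by `2^{|j|²-1}` absorbs the
divisions by the order, and the growing left side `2^q = |j|²` is what makes the step close. -/
theorem le_leadCoef (hd : 2 ≤ d) {lam : ℝ} (hlam : |lam| = 1) (q : ℕ) :
    ∀ j ∈ extremalModes hd, normSq j = 2 ^ q →
      (2 : ℝ) ^ q ≤ leadCoef d hlam (2 ^ q - 1) j * 2 ^ (2 ^ q - 1) := by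
  induction q with
  | zero =>
    intro j hj h1
    have := one_le_datum hd hj (by simpa using h1)
    simpa [leadCoef, resCoef, taylor_zero] using this
  | succ q ih =>
    intro j hj hq
    obtain ⟨k, hk, k', hk', hn, hn', hne, rfl⟩ := exists_extremal_add hd hj hq
    have hk1 := ih k hk hn
    have hk2 := ih k' hk' hn'
    obtain ⟨p, hp⟩ : ∃ p, 2 ^ q = p + 1 :=
      ⟨2 ^ q - 1, by have := Nat.one_le_two_pow (n := q); omega⟩
    have hp' : 2 ^ (q + 1) = 2 * p + 2 := by rw [pow_succ]; omega
    have h := two_mul_leadCoef_mul_le hd hlam (hn.trans hp) (hn'.trans hp) hne (hq.trans hp')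
    rw [hp, Nat.add_sub_cancel] at hk1 hk2
    rw [hp', show 2 * p + 2 - 1 = 2 * p + 1 by omega]
    have hpr : (2 : ℝ) ^ q = p + 1 := by exact_mod_cast hp
    rw [hpr] at hk1 hk2
    rw [pow_succ, hpr]
    have hp0 : (0 : ℝ) ≤ p := Nat.cast_nonneg p
    set x := leadCoef d hlam p k
    set y := leadCoef d hlam p k'
    set z := leadCoef d hlam (2 * p + 1) (k + k')
    have h3 : ((p : ℝ) + 1) * (p + 1) ≤ (x * 2 ^ p) * (y * 2 ^ p) :=
      mul_le_mul hk1 hk2 (by positivity) (le_trans (by positivity) hk1)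
    have h4 : (2 * p + 1 : ℝ) * (z * 2 ^ (2 * p + 1)) ≥ 4 * ((x * 2 ^ p) * (y * 2 ^ p)) := by
      have : (2 : ℝ) ^ (2 * p + 1) = 2 * (2 ^ p * 2 ^ p) := by ring
      rw [this]
      have := mul_le_mul_of_nonneg_right h (by positivity : (0 : ℝ) ≤ 2 * (2 ^ p * 2 ^ p))
      linarith
    -- With `n = p + 1`, the two lower bounds give `(2n - 1) · z 2^{2n-1} ≥ 4n²`, whereas failure of
    -- the claim would give at most `(2n - 1) · 2n < 4n²`.
    by_contra! hlt
    have : (2 * p + 1 : ℝ) * (z * 2 ^ (2 * p + 1)) ≤ (2 * p + 1) * ((p + 1) * 2) := by gcongr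
    nlinarith

theorem one_le_leadCoef (hd : 2 ≤ d) {lam : ℝ} (hlam : |lam| = 1) {j : Fin d → ℤ}
    (hj : j ∈ extremalModes hd) :
    1 ≤ ‖resCoef d hlam (normSq j - 1) j‖ * 2 ^ (normSq j - 1) := by
  obtain ⟨q, hq⟩ := normSq_extremal hd hj
  have h := le_leadCoef hd hlam q j hj hq
  rw [← hq] at h
  have h1 : (1 : ℝ) ≤ 2 ^ q := one_le_pow₀ (by norm_num)
  have h2 := leadCoef_le_norm hlam (normSq j - 1) j
  have h3 : leadCoef d hlam (normSq j - 1) j * 2 ^ (normSq j - 1)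
      ≤ ‖resCoef d hlam (normSq j - 1) j‖ * 2 ^ (normSq j - 1) := by gcongr
  linarith

theorem normSq_pos_of_extremal (hd : 2 ≤ d) {j : Fin d → ℤ} (hj : j ∈ extremalModes hd) :
    0 < normSq j := by
  obtain ⟨q, hq⟩ := normSq_extremal hd hj
  rw [hq]; positivity

/-- The Taylor polynomial at the frequency `j` is its monomial of degree `|j|² - 1`, up to
terms of higher order. -/
theorem norm_taylorPoly_sub_le (hd : 2 ≤ d) {lam : ℝ} (hlam : |lam| = 1) {j : Fin d → ℤ}
    (hj : 0 < normSq j) {N : ℕ} (hN : normSq j ≤ N) {τ : ℝ} (h0 : 0 ≤ τ) (hτ : τ ≤ 1 / 200) :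
    ‖taylorPoly (resonant hlam) (datum d) N τ j
      - (τ : ℂ) ^ (normSq j - 1) * resCoef d hlam (normSq j - 1) j‖
      ≤ 10 * (200 * τ) ^ normSq j := by
  have e : taylorPoly (resonant hlam) (datum d) N τ j
      = ∑ m ∈ Finset.range (N + 1), (τ : ℂ) ^ m * resCoef d hlam m j := by
    rw [taylorPoly, ← Ell1.eval_apply, map_sum]
    refine Finset.sum_congr rfl fun m _ => ?_
    rw [map_smul, Complex.real_smul, Complex.ofReal_pow]
    rfl
  -- All orders `m < |j|² - 1` vanish at `j`; the orders from `|j|²` on form the tail.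
  have hlow : ∑ m ∈ Finset.range (normSq j), (τ : ℂ) ^ m * resCoef d hlam m j
      = (τ : ℂ) ^ (normSq j - 1) * resCoef d hlam (normSq j - 1) j := by
    refine Finset.sum_eq_single (normSq j - 1) (fun m hm hne => ?_) fun h => ?_
    · have := Finset.mem_range.1 hm
      rw [(leadingAt hd hlam m).1 j (by omega), mul_zero]
    · exact absurd (Finset.mem_range.2 (by omega)) h
  rw [e, ← Finset.sum_range_add_sum_Ico _ (by omega : normSq j ≤ N + 1), hlow,
    add_sub_cancel_left]
  refine (norm_sum_le _ _).trans (le_trans ?_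
    (sum_norm_taylor_tail_le (norm_resonant_le (d := d) hlam) norm_datum_le (normSq j) (N + 1)
      h0 hτ))
  refine Finset.sum_le_sum fun m _ => ?_
  rw [norm_mul, norm_pow, Complex.norm_real, Real.norm_of_nonneg h0]
  gcongr
  exact Ell1.norm_apply_le _ _

end Extremal

/-! ### The time layers -/

section Layers

variable {d : ℕ}

theorem mul_ignitionTime {ε : ℝ} (hε : 0 < ε) (γ : ℝ) (j : Fin d → ℤ) :
    ε * ignitionTime ε γ j = 2 * ε ^ (γ / ((normSq j : ℝ) - 1)) := by
  rw [ignitionTime, Real.rpow_sub hε, Real.rpow_one]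
  field_simp

/-- Since `4000 ≤ e^9`, the logarithm of the left side is at most `9n - γ log(1/ε)/(n-1) ≤ 9n - 10n
≤ -2`, and `e^{-2} ≤ 1/4`. -/
theorem pow_mul_rpow_le {ε γ : ℝ} (hε : 0 < ε) {n : ℕ} (hn : 2 ≤ n)
    (h : 10 * (n : ℝ) ^ 2 ≤ γ * Real.log (1 / ε)) :
    4000 ^ n * ε ^ (γ / ((n : ℝ) - 1)) ≤ 1 / 4 := by
  have hn' : (2 : ℝ) ≤ n := by exact_mod_cast hn
  have h1 : (2.7 : ℝ) ≤ Real.exp 1 := by linarith [Real.exp_one_gt_d9]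
  have h9 : (4000 : ℝ) ≤ Real.exp 9 := by
    rw [show (9 : ℝ) = (9 : ℕ) * 1 by norm_num, Real.exp_nat_mul]
    exact le_trans (by norm_num) (pow_le_pow_left₀ (by norm_num) h1 9)
  have h2 : (4 : ℝ) ≤ Real.exp 2 := by
    rw [show (2 : ℝ) = (2 : ℕ) * 1 by norm_num, Real.exp_nat_mul]
    exact le_trans (by norm_num) (pow_le_pow_left₀ (by norm_num) h1 2)
  have hlog : Real.log ε = -Real.log (1 / ε) := by rw [one_div, Real.log_inv, neg_neg]
  have h3 : 10 * (n : ℝ) ≤ γ * Real.log (1 / ε) / (n - 1) := by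
    rw [le_div_iff₀ (by linarith)]
    nlinarith
  calc 4000 ^ n * ε ^ (γ / ((n : ℝ) - 1))
      ≤ Real.exp 9 ^ n * ε ^ (γ / ((n : ℝ) - 1)) := by gcongr
    _ = Real.exp (n * 9 - γ * Real.log (1 / ε) / (n - 1)) := by
        rw [Real.rpow_def_of_pos hε, hlog, ← Real.exp_nat_mul, ← Real.exp_add]
        congr 1
        ring
    _ ≤ Real.exp (-2) := Real.exp_le_exp.2 (by linarith)
    _ ≤ 1 / 4 := by
        rw [Real.exp_neg, one_div]
        exact inv_anti₀ (by norm_num) h2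

/-- The thresholds on `ε` used below: `L^{4θ}` is negligible against `L = log(1/ε)` because `4θ <
1`, and `ε` is negligible against `ε^γ` because `γ < 1`. -/
theorem eventually_layer {γ θ α C : ℝ} (hγ0 : 0 < γ) (hγ1 : γ < 1) (hθ : θ < 1 / 4) :
    ∀ᶠ ε : ℝ in 𝓝[>] 0, 0 < Real.log (1 / ε) ∧
      10 * α ^ 4 * Real.log (1 / ε) ^ (4 * θ) ≤ γ * Real.log (1 / ε) ∧ C * ε ^ (1 - γ) ≤ 1 / 4 := by
  have hL : Tendsto (fun ε : ℝ => Real.log (1 / ε)) (𝓝[>] 0) atTop := by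
    simp only [one_div]
    exact Real.tendsto_log_atTop.comp tendsto_inv_nhdsGT_zero
  have h1 : Tendsto (fun L : ℝ => 10 * α ^ 4 * L ^ (-(1 - 4 * θ))) atTop (𝓝 0) := by
    simpa using (tendsto_rpow_neg_atTop (by linarith : 0 < 1 - 4 * θ)).const_mul (10 * α ^ 4)
  have h2 : Tendsto (fun ε : ℝ => C * ε ^ (1 - γ)) (𝓝[>] 0) (𝓝 0) := by
    have : ContinuousAt (fun ε : ℝ => C * ε ^ (1 - γ)) 0 :=
      continuousAt_const.mul (Real.continuousAt_rpow_const _ _ (Or.inr (by linarith)))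
    have := this.tendsto.mono_left (nhdsWithin_le_nhds (s := Ioi 0))
    simpa [Real.zero_rpow (by linarith : 1 - γ ≠ 0)] using this
  have h3 : ∀ᶠ L : ℝ in atTop, 0 < L ∧ 10 * α ^ 4 * L ^ (4 * θ) ≤ γ * L := by
    filter_upwards [eventually_gt_atTop 0, h1.eventually (gt_mem_nhds hγ0)] with L hL0 hL1
    refine ⟨hL0, ?_⟩
    have : L ^ (4 * θ) = L ^ (-(1 - 4 * θ)) * L := by
      rw [← Real.rpow_add_one hL0.ne']; congr 1; ring
    rw [this, ← mul_assoc]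
    exact mul_le_mul_of_nonneg_right hL1.le hL0.le
  filter_upwards [hL.eventually h3, h2.eventually (gt_mem_nhds (by norm_num : (0 : ℝ) < 1 / 4))]
    with ε hε1 hε2
  exact ⟨hε1.1, hε1.2, hε2.le⟩

theorem ten_mul_normSq_sq_le {γ θ α ε : ℝ} (hL : 0 < Real.log (1 / ε))
    (h : 10 * α ^ 4 * Real.log (1 / ε) ^ (4 * θ) ≤ γ * Real.log (1 / ε)) {j : Fin d → ℤ}
    (hj : length j < α * Real.log (1 / ε) ^ θ) :
    10 * (normSq j : ℝ) ^ 2 ≤ γ * Real.log (1 / ε) := by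
  have h1 : length j ^ 4 ≤ (α * Real.log (1 / ε) ^ θ) ^ 4 :=
    pow_le_pow_left₀ (Real.sqrt_nonneg _) hj.le 4
  have h2 : length j ^ 4 = (normSq j : ℝ) ^ 2 := by
    rw [show length j ^ 4 = (length j ^ 2) ^ 2 by ring, length,
      Real.sq_sqrt (Nat.cast_nonneg _)]
  have h3 : (Real.log (1 / ε) ^ θ) ^ 4 = Real.log (1 / ε) ^ (4 * θ) := by
    rw [← Real.rpow_natCast, ← Real.rpow_mul hL.le]; congr 1; push_cast; ring
  rw [h2, mul_pow, h3] at h1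
  linarith

end Layers

/-! ### Assembly in the original variables -/

section Main

variable {d : ℕ}

theorem mul_mem_Icc {ε t : ℝ} (hε : 0 < ε) {T : ℝ} (ht : t ∈ Icc 0 (T / ε)) :
    ε * t ∈ Icc 0 T :=
  ⟨mul_nonneg hε.le ht.1, by rw [mul_comm]; exact (le_div_iff₀ hε).1 ht.2⟩

/-- The profile in the original time variable. -/
theorem hasDerivWithinAt_rescaled {lam ε : ℝ} (hlam : |lam| = 1) (hε : 0 < ε) {T : ℝ}
    {b : ℝ → Ell1 (Fin d → ℤ)} (hb : ∀ τ ∈ Icc 0 T, HasDerivWithinAt b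
      (nl (fullW lam (τ / ε)) (norm_fullW hlam _) (b τ) (b τ) (b τ)) (Icc 0 T) τ) :
    ∀ t ∈ Icc 0 (T / ε), HasDerivWithinAt (fun t => b (ε * t))
      (ε • nl (fullW lam t) (norm_fullW hlam t) (b (ε * t)) (b (ε * t)) (b (ε * t)))
      (Icc 0 (T / ε)) t := by
  intro t ht
  have h1 : HasDerivWithinAt (fun t : ℝ => ε * t) ε (Icc 0 (T / ε)) t := by
    simpa using ((hasDerivAt_id' t).const_mul ε).hasDerivWithinAt
  have h2 := (hb (ε * t) (mul_mem_Icc hε ht)).scomp t h1 fun s hs => mul_mem_Icc hε hs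
  simp only [mul_div_cancel_left₀ t hε.ne'] at h2
  exact h2

theorem unique_solution (hd : 2 ≤ d) {lam ε : ℝ} (hlam : |lam| = 1) {τ : ℝ} (hτ : 0 ≤ τ)
    {a : ℝ → Ell1 (Fin d → ℤ)} (h0 : a 0 = datum d)
    (ha : ∀ t ∈ Icc 0 τ, HasDerivWithinAt a
      (ε • nl (fullW lam t) (norm_fullW hlam t) (a t) (a t) (a t)) (Icc 0 τ) t)
    {v : ℝ → Torus d → ℂ} (hv : IsNLSSolution (lam * ε) (fiveMode hd) τ v) :
    EqOn v (fun t => synth (flow t (a t))) (Icc 0 τ) := by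
  obtain ⟨a', hv', ha'⟩ := hv.exists_profile hlam
  have h0' : a' 0 = datum d := by
    have h1 := hv' 0 ⟨le_rfl, hτ⟩
    rw [hv.initial, ← synth_datum] at h1
    rw [synth_injective h1]
    exact Ell1.ext' fun j => by rw [flow_apply, phase_zero, one_mul]
  intro t ht
  simp only [hv' t ht, profile_unique hlam ha' ha (h0'.trans h0.symm) ht]

theorem norm_coeff_sub_le (hd : 2 ≤ d) {lam : ℝ} (hlam : |lam| = 1) {C ε : ℝ} (hC : 0 < C)
    (hε : 0 < ε) {b : ℝ → Ell1 (Fin d → ℤ)}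
    (hb : ∀ N : ℕ, ∀ τ ∈ Icc (0 : ℝ) (1 / 400),
      ‖b τ - taylorPoly (resonant hlam) (datum d) N τ‖ ≤ C * (ε + (1 / 2) ^ N))
    {j : Fin d → ℤ} (hj : j ∈ extremalModes hd) {t : ℝ} (ht : t ∈ Icc 0 (1 / 400 / ε)) :
    ‖coeff (synth (flow t (b (ε * t)))) j -
        resCoef d hlam (normSq j - 1) j * ((ε * t : ℝ) : ℂ) ^ (normSq j - 1) *
          Complex.exp (-(Complex.I * (t : ℂ) * (normSq j : ℂ)))‖
      ≤ (2000 * ε * t) ^ normSq j + 2 * C * ε := by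
  have hτ := mul_mem_Icc hε ht
  have hn := normSq_pos_of_extremal hd hj
  obtain ⟨M, hM⟩ := exists_pow_lt_of_lt_one hε (by norm_num : (1 / 2 : ℝ) < 1)
  -- The polynomial degree is free: it is taken at least `|j|²`, to contain the leading monomial,
  -- and large enough that `2^{-N} ≤ ε`. The averaging error is then at most `2Cε`.
  set N := max M (normSq j)
  have hN : (1 / 2 : ℝ) ^ N ≤ ε :=
    (pow_le_pow_of_le_one (by norm_num) (by norm_num) (le_max_left _ _)).trans hM.le
  have h1 := hb N _ hτ
  have h2 := norm_taylorPoly_sub_le hd hlam hn (le_max_right M (normSq j)) hτ.1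
    (hτ.2.trans (by norm_num))
  have h3 := (Ell1.norm_apply_le (b (ε * t) - taylorPoly (resonant hlam) (datum d) N (ε * t))
    j).trans h1
  rw [Ell1.sub_apply'] at h3
  have h4 : coeff (synth (flow t (b (ε * t)))) j -
        resCoef d hlam (normSq j - 1) j * ((ε * t : ℝ) : ℂ) ^ (normSq j - 1) *
          Complex.exp (-(Complex.I * (t : ℂ) * (normSq j : ℂ)))
      = phase t j * ((b (ε * t) j - taylorPoly (resonant hlam) (datum d) N (ε * t) j) +
        (taylorPoly (resonant hlam) (datum d) N (ε * t) j -
          ((ε * t : ℝ) : ℂ) ^ (normSq j - 1) * resCoef d hlam (normSq j - 1) j)) := by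
    rw [coeff_synth, flow_apply, phase]
    ring
  rw [h4, norm_mul, norm_phase, one_mul]
  refine (norm_add_le _ _).trans ?_
  -- As `|j|² ≥ 1`, the prefactor 10 can be moved inside the power, whence `2000 = 10 · 200`.
  have h5 : 10 * (200 * (ε * t)) ^ normSq j ≤ (2000 * ε * t) ^ normSq j := by
    have h6 : (10 : ℝ) ≤ 10 ^ normSq j := le_self_pow₀ (by norm_num) hn.ne'
    have h7 : (2000 * ε * t) ^ normSq j = 10 ^ normSq j * (200 * (ε * t)) ^ normSq j := by
      rw [← mul_pow]; congr 1; ring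
    rw [h7]
    exact mul_le_mul_of_nonneg_right h6 (pow_nonneg (mul_nonneg (by norm_num) hτ.1) _)
  have h8 : C * (ε + (1 / 2) ^ N) ≤ C * (ε + ε) := by gcongr
  linarith

/-- The lower bound at the ignition time. -/
theorem le_norm_of_layer (hd : 2 ≤ d) {lam : ℝ} (hlam : |lam| = 1) {C ε γ : ℝ}
    (hε : 0 < ε) {j : Fin d → ℤ} (hj : j ∈ extremalModes hd) (hj2 : 2 ≤ normSq j)
    (hL : 10 * (normSq j : ℝ) ^ 2 ≤ γ * Real.log (1 / ε)) (hCε : C * ε ^ (1 - γ) ≤ 1 / 4)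
    {f : Torus d → ℂ}
    (hf : ignitionTime ε γ j ∈ Icc 0 (1 / 400 / ε) →
      ‖coeff f j - resCoef d hlam (normSq j - 1) j *
          ((ε * ignitionTime ε γ j : ℝ) : ℂ) ^ (normSq j - 1) *
          Complex.exp (-(Complex.I * (ignitionTime ε γ j : ℂ) * (normSq j : ℂ)))‖
        ≤ (2000 * ε * ignitionTime ε γ j) ^ normSq j + C * ε) :
    ignitionTime ε γ j ∈ Icc 0 (1 / 400 / ε) ∧ ε ^ γ / 4 ≤ ‖coeff f j‖ := by
  set n := normSq j with hn
  set t := ignitionTime ε γ j with ht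
  set s := ε ^ (γ / ((n : ℝ) - 1)) with hs
  have hs0 : 0 < s := Real.rpow_pos_of_pos hε _
  have hεt : ε * t = 2 * s := mul_ignitionTime hε γ j
  have hsmall : 4000 ^ n * s ≤ 1 / 4 := pow_mul_rpow_le hε hj2 hL
  have h4000 : (4000 : ℝ) ≤ 4000 ^ n := le_self_pow₀ (by norm_num) (by omega)
  have hs1 : 4000 * s ≤ 1 / 4 := (mul_le_mul_of_nonneg_right h4000 hs0.le).trans hsmall
  have htmem : t ∈ Icc 0 (1 / 400 / ε) := by
    constructor
    · rw [ht, ignitionTime]; positivity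
    · rw [le_div_iff₀ hε, mul_comm, hεt]; linarith
  refine ⟨htmem, ?_⟩
  have hmain := hf htmem
  have hn1 : (n : ℝ) - 1 ≠ 0 := by
    have : (2 : ℝ) ≤ n := by exact_mod_cast hj2
    linarith
  have hpow : s ^ (n - 1) = ε ^ γ := by
    rw [hs, ← Real.rpow_natCast, ← Real.rpow_mul hε.le, Nat.cast_sub (by omega), Nat.cast_one,
      div_mul_cancel₀ _ hn1]
  have hγ : 0 < ε ^ γ := Real.rpow_pos_of_pos hε _
  -- The base `εt = 2s` supplies `2^{n-1}`, exactly the normalisation in the lower bound for the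
  -- leading coefficient.
  have h1 : ε ^ γ ≤ ‖resCoef d hlam (n - 1) j * ((ε * t : ℝ) : ℂ) ^ (n - 1) *
      Complex.exp (-(Complex.I * (t : ℂ) * (n : ℂ)))‖ := by
    have hph : ‖Complex.exp (-(Complex.I * (t : ℂ) * (n : ℂ)))‖ = 1 := norm_phase t j
    rw [norm_mul, hph, mul_one, norm_mul, norm_pow, Complex.norm_real, hεt,
      Real.norm_of_nonneg (by positivity), mul_pow, hpow, ← mul_assoc]
    exact le_mul_of_one_le_left hγ.le (one_le_leadCoef hd hlam hj)
  -- The remainder is `(4000 s)^n = (4000^n s) · s^{n-1}`: one spare power of `s` beats `4000^n`,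
  -- and the other powers make `ε^γ`.
  have h2 : (2000 * ε * t) ^ n ≤ ε ^ γ / 4 := by
    have : (2000 * ε * t) ^ n = (4000 ^ n * s) * ε ^ γ := by
      rw [mul_assoc, hεt, ← mul_assoc, mul_pow, ← hpow, mul_assoc, ← pow_succ',
        Nat.sub_add_cancel (by omega)]
      norm_num
    rw [this]
    nlinarith
  have h3 : C * ε ≤ ε ^ γ / 4 := by
    have : ε = ε ^ (1 - γ) * ε ^ γ := by
      rw [← Real.rpow_add hε, sub_add_cancel, Real.rpow_one]
    calc C * ε = C * ε ^ (1 - γ) * ε ^ γ := by rw [mul_assoc, ← this]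
      _ ≤ 1 / 4 * ε ^ γ := by gcongr
      _ = _ := by ring
  have h4 := norm_sub_norm_le (resCoef d hlam (n - 1) j * ((ε * t : ℝ) : ℂ) ^ (n - 1) *
      Complex.exp (-(Complex.I * (t : ℂ) * (n : ℂ)))) (coeff f j)
  rw [norm_sub_rev] at h4
  linarith

theorem two_le_normSq {j : Fin d → ℤ} (hj : 1 < length j) : 2 ≤ normSq j := by
  by_contra! h
  have h1 : (normSq j : ℝ) ≤ 1 := by exact_mod_cast Nat.le_of_lt_succ h
  exact absurd hj (not_lt.2 (Real.sqrt_le_one.2 h1))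

end Main

end NLSCascade

end

theorem theorem1p1 (d : ℕ) (hd : 2 ≤ d) (lam : ℝ) (hlam : lam = 1 ∨ lam = -1) :
    ∃ ε₀ T : ℝ, 0 < ε₀ ∧ 0 < T ∧
    ∃ u : ℝ → ℝ → NLSCascade.Torus d → ℂ,
      -- existence and uniqueness of the solution `u ε` in `C([0,T/ε]; W)`
      (∀ ε ∈ Set.Ioc 0 ε₀,
        NLSCascade.IsNLSSolution (lam * ε) (NLSCascade.fiveMode hd) (T / ε) (u ε) ∧
        ∀ v : ℝ → NLSCascade.Torus d → ℂ,
          NLSCascade.IsNLSSolution (lam * ε) (NLSCascade.fiveMode hd) (T / ε) v →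
          Set.EqOn v (u ε) (Set.Icc 0 (T / ε))) ∧
      -- description of the extremal modes, with constants independent of `ε`
      (∃ C₀ C : ℝ, 0 < C₀ ∧ 0 < C ∧
        ∀ j ∈ NLSCascade.extremalModes hd, ∃ c : ℂ, c ≠ 0 ∧
          ∀ ε ∈ Set.Ioc 0 ε₀, ∀ t ∈ Set.Icc 0 (T / ε),
            ‖NLSCascade.coeff (u ε t) j -
                c * ((ε * t : ℝ) : ℂ) ^ (NLSCascade.normSq j - 1) *
                  Complex.exp (-(Complex.I * (t : ℂ) * (NLSCascade.normSq j : ℂ)))‖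
              ≤ (C₀ * ε * t) ^ NLSCascade.normSq j + C * ε) ∧
      -- the cascade of time layers
      (∀ γ ∈ Set.Ioo (0 : ℝ) 1, ∀ θ : ℝ, θ < 1 / 4 → ∀ α : ℝ, 0 < α →
        ∃ ε₁ ∈ Set.Ioc 0 ε₀, ∀ ε ∈ Set.Ioc 0 ε₁, ∀ j ∈ NLSCascade.extremalModes hd,
          1 < NLSCascade.length j →
          NLSCascade.length j < α * Real.log (1 / ε) ^ θ →
          NLSCascade.ignitionTime ε γ j ∈ Set.Icc 0 (T / ε) ∧
          ε ^ γ / 4 ≤ ‖NLSCascade.coeff (u ε (NLSCascade.ignitionTime ε γ j)) j‖) := by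
  open NLSCascade in
  have habs : |lam| = 1 := by rcases hlam with rfl | rfl <;> simp
  -- The profile exists for every real `ε`, so `u` is defined without restriction; positivity of `ε`
  -- enters only in the return to the time `t`.
  choose b hb0 hb using fun ε => exists_profile habs ε (norm_datum_le (d := d))
  obtain ⟨C, hC, happrox⟩ := exists_norm_profile_sub_taylorPoly_le (d := d)
  have happ : ∀ ε ∈ Ioc (0 : ℝ) 1, ∀ N : ℕ, ∀ τ ∈ Icc (0 : ℝ) (1 / 400),
      ‖b ε τ - taylorPoly (resonant habs) (datum d) N τ‖ ≤ C * (ε + (1 / 2) ^ N) :=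
    fun ε hε N τ hτ => by
      have := happrox habs hε.1 hε.2 (b ε) (by rw [hb0]; exact norm_datum_le) (hb ε) N τ hτ
      rwa [hb0] at this
  have hder : ∀ ε ∈ Ioc (0 : ℝ) 1, _ := fun ε hε =>
    hasDerivWithinAt_rescaled habs hε.1 fun τ hτ => (hb ε τ hτ).2
  have hzero : ∀ ε, b ε (ε * 0) = datum d := fun ε => by rw [mul_zero, hb0]
  refine ⟨1, 1 / 400, one_pos, by norm_num, fun ε t => synth (flow t (b ε (ε * t))), ?_, ?_, ?_⟩
  · refine fun ε hε => ⟨?_, fun v hv => ?_⟩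
    · have := isNLSSolution_synth_flow habs (hder ε hε)
      rwa [hzero, synth_datum hd] at this
    · exact unique_solution hd habs (div_nonneg (by norm_num) hε.1.le)
        (hzero ε) (hder ε hε) hv
  · refine ⟨2000, 2 * C, by norm_num, by positivity, fun j hj =>
      ⟨resCoef d habs (normSq j - 1) j, fun h => ?_, fun ε hε t ht =>
        norm_coeff_sub_le hd habs hC hε.1 (happ ε hε) hj ht⟩⟩
    have := one_le_leadCoef hd habs hj
    rw [h, norm_zero, zero_mul] at this
    linarith
  · intro γ hγ θ hθ α _
    -- The constant passed here is `2 * C`, matching the error `2Cε` of the mode description. The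
    -- threshold depends on `γ`, `θ`, `α` but not on the mode `j`.
    obtain ⟨ε₁, hε₁, hsub⟩ := mem_nhdsGT_iff_exists_Ioc_subset.1
      (eventually_layer (α := α) (C := 2 * C) hγ.1 hγ.2 hθ)
    refine ⟨min ε₁ 1, ⟨lt_min hε₁ one_pos, min_le_right _ _⟩, fun ε hε j hj hj1 hjα => ?_⟩
    have hε' : ε ∈ Ioc (0 : ℝ) 1 := ⟨hε.1, hε.2.trans (min_le_right _ _)⟩
    obtain ⟨hL, h10, hCε⟩ := hsub ⟨hε.1, hε.2.trans (min_le_left _ _)⟩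
    exact le_norm_of_layer hd habs hε.1 hj (two_le_normSq hj1) (ten_mul_normSq_sq_le hL h10 hjα)
      hCε fun ht => norm_coeff_sub_le hd habs hC hε.1 (happ ε hε') hj ht
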